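/- Let $N\ge 1$, let $m>1$, set $\alpha=\frac{1}{m-1}$, and let $\Omega\subset\mathbb{R}^N$ be an open bounded set. Put $\Phi(s)=|s|^{m-1}s$ and $g(s)=|s|^{\frac{m-1}{2}}s$ for $s\in\mathbb{R}$, and $Q=\Omega\times(0,+\infty)$. Let $W^{1,2}_0(\Omega)$ be the closure of $C^\infty_0(\Omega)$ in the norm $\|\varphi\|_{L^2(\Omega)}+\|\nabla\varphi\|_{L^2(\Omega)}$. Let $u_0\in L^{m+1}(\Omega)$ be such that $\Phi(u_0)\in W^{1,2}_0(\Omega)$, and let $v\in C([0,+\infty);L^{m+1}(\Omega))$ be the weak solution of \[ \partial_t v=\Delta\Phi(v)+\alpha\,v\ \text{ in }Q,\qquad v=0\ \text{ on }\partial\Omega\times(0,+\infty),\qquad v(\cdot,0)=u_0\ \text{ in }\Omega, \] that is: $\Phi(v)\in L^2_{\rm loc}([0,+\infty);W^{1,2}_0(\Omega))$, \[ \iint_Q\big(\langle\nabla\Phi(v),\nabla\eta\rangle-v\,\partial_t\eta\big)\,dx\,dt=\alpha\iint_Q v\,\eta\,dx\,dt\qquad\text{for every }\eta\in C^\infty_0(Q),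 \] and $\lim_{t\to0^+}\|v(\cdot,t)-u_0\|_{L^{m+1}(\Omega)}=0$. Suppose that there exists $T_0>0$ such that \[ \partial_t g(v)\in L^2([T_0,+\infty);L^2(\Omega))\qquad\text{and}\qquad\nabla\Phi(v)\in L^\infty([T_0,+\infty);L^2(\Omega)). \] Let $\psi\in L^{m+1}(\Omega)$ be any $\omega$-limit point of $v$, i.e. $\lim_{n\to\infty}\|v(\cdot,t_n)-\psi\|_{L^{m+1}(\Omega)}=0$ for some sequence of times $t_n\nearrow+\infty$. Then $\Phi(\psi)\in W^{1,2}_0(\Omega)$, and $U=\Phi(\psi)$ is a weak solution of the Lane–Emden equation $-\Delta U=\alpha\,|U|^{q-2}\,U$ in $\Omega$ with $q=\frac{m+1}{m}$, that is, \[ \int_\Omega\langle\nabla U,\nabla\varphi\rangle\,dx=\alpha\int_\Omega|U|^{q-2}\,U\,\varphi\,dx\qquad\text{for every }\varphi\in W^{1,2}_0(\Omega). \] -/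

import Mathlib

open MeasureTheory Filter Topology Set
open scoped ContDiff ENNReal

namespace PorousMedium

noncomputable section

/-- `ℝ^N` with its Euclidean norm. -/
abbrev Space (N : ℕ) : Type := EuclideanSpace ℝ (Fin N)

/-- The nonlinearity `Φ(s) = |s|^(m-1) s`. -/
def Phi (m s : ℝ) : ℝ := |s| ^ (m - 1) * s

/-- The nonlinearity `g(s) = |s|^((m-1)/2) s`. -/
def g (m s : ℝ) : ℝ := |s| ^ ((m - 1) / 2) * s

/-- `φ ∈ C_0^∞(U)`: smooth, with compact support contained in `U`. -/
structure IsTest {X : Type*} [NormedAddCommGroup X] [NormedSpace ℝ X]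
    (U : Set X) (φ : X → ℝ) : Prop where
  smooth : ContDiff ℝ ∞ φ
  compact : HasCompactSupport φ
  support_subset : tsupport φ ⊆ U

variable {N : ℕ}

theorem gradient_add_test {φ χ : Space N → ℝ} (hφ : ContDiff ℝ ∞ φ) (hχ : ContDiff ℝ ∞ χ)
    (x : Space N) : gradient (φ + χ) x = gradient φ x + gradient χ x := by
  unfold gradient
  rw [fderiv_add (hφ.differentiable (by simp) x) (hχ.differentiable (by simp) x), map_add]

theorem gradient_smul_test {φ : Space N → ℝ} (hφ : ContDiff ℝ ∞ φ) (c : ℝ)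
    (x : Space N) : gradient (c • φ) x = c • gradient φ x := by
  unfold gradient
  rw [fderiv_const_smul (hφ.differentiable (by simp) x), map_smulₛₗ]
  simp

/-- The pairs `(φ, ∇φ)` in `L²(Ω) × L²(Ω;ℝ^N)`, for `φ ∈ C_0^∞(Ω)`. -/
def testGraph (Ω : Set (Space N)) : Submodule ℝ
    (WithLp 2 (Lp ℝ 2 (volume.restrict Ω) × Lp (Space N) 2 (volume.restrict Ω))) where
  carrier := {p | ∃ φ : Space N → ℝ, IsTest Ω φ ∧
    p.fst =ᵐ[volume.restrict Ω] φ ∧ p.snd =ᵐ[volume.restrict Ω] gradient φ}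
  add_mem' := by
    rintro p p' ⟨φ, hφ, h1, h2⟩ ⟨χ, hχ, h1', h2'⟩
    refine ⟨φ + χ, ⟨hφ.smooth.add hχ.smooth, hφ.compact.add hχ.compact, ?_⟩, ?_, ?_⟩
    · exact (tsupport_add φ χ).trans (union_subset hφ.support_subset hχ.support_subset)
    · rw [WithLp.add_fst]
      exact (Lp.coeFn_add _ _).trans (h1.add h1')
    · rw [WithLp.add_snd]
      filter_upwards [Lp.coeFn_add p.snd p'.snd, h2, h2'] with x hx hx2 hx2'
      rw [hx, Pi.add_apply, hx2, hx2', gradient_add_test hφ.smooth hχ.smooth]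
  zero_mem' := by
    refine ⟨0, ⟨contDiff_const, HasCompactSupport.zero, by simp [tsupport]⟩, ?_, ?_⟩
    · rw [WithLp.zero_fst]; exact Lp.coeFn_zero _ _ _
    · rw [WithLp.zero_snd]
      filter_upwards [Lp.coeFn_zero (Space N) 2 (volume.restrict Ω)] with x hx
      rw [hx]; simp [gradient]
  smul_mem' := by
    rintro c p ⟨φ, hφ, h1, h2⟩
    refine ⟨c • φ, ⟨hφ.smooth.const_smul c, ?_, ?_⟩, ?_, ?_⟩
    · exact hφ.compact.smul_left (f := fun _ => c)
    · exact (closure_mono (Function.support_const_smul_subset c φ)).trans hφ.support_subset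
    · rw [WithLp.smul_fst]
      exact (Lp.coeFn_smul _ _).trans (h1.const_smul c)
    · rw [WithLp.smul_snd]
      filter_upwards [Lp.coeFn_smul c p.snd, h2] with x hx hx2
      rw [hx, Pi.smul_apply, hx2, gradient_smul_test hφ.smooth]

/-- `W^{1,2}_0(Ω)` as a closed subspace of `L²(Ω) × L²(Ω;ℝ^N)`: the closure of `C_0^∞(Ω)` in the `W^{1,2}` norm. An element is the pair of
a function in `L²(Ω)` and its weak gradient in `L²(Ω;ℝ^N)`; the gradient is
determined by the function (`SobolevZero.ext_fn` below). -/
def sobolevZero (Ω : Set (Space N)) : Submodule ℝ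
    (WithLp 2 (Lp ℝ 2 (volume.restrict Ω) × Lp (Space N) 2 (volume.restrict Ω))) :=
  (testGraph Ω).topologicalClosure

/-- The Hilbert space `W^{1,2}_0(Ω)`, with norm `(‖u‖²_{L²} + ‖∇u‖²_{L²})^{1/2}`. -/
abbrev SobolevZero (Ω : Set (Space N)) : Type := sobolevZero Ω

namespace SobolevZero

/-- The function underlying an element of `W^{1,2}_0(Ω)`. -/
def fn {Ω : Set (Space N)} (u : SobolevZero Ω) : Lp ℝ 2 (volume.restrict Ω) := u.1.fst

/-- The weak gradient of an element of `W^{1,2}_0(Ω)`. -/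
def grad {Ω : Set (Space N)} (u : SobolevZero Ω) : Lp (Space N) 2 (volume.restrict Ω) := u.1.snd

/-- `grad u` is the distributional gradient of `u`. -/
theorem integral_fn_mul_fderiv {Ω : Set (Space N)} (u : SobolevZero Ω) {φ : Space N → ℝ}
    (hφ : IsTest Ω φ) (e : Space N) :
    ∫ x in Ω, u.fn x * fderiv ℝ φ x e = - ∫ x in Ω, φ x * inner ℝ (u.grad x) e := by
  have hcd : Continuous fun x => fderiv ℝ φ x e :=
    (hφ.smooth.continuous_fderiv (by simp)).clm_apply continuous_const
  have hcs : HasCompactSupport fun x => fderiv ℝ φ x e :=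
    (hφ.compact.fderiv_apply (𝕜 := ℝ) e)
  have hA : MemLp (fun x => fderiv ℝ φ x e) 2 (volume.restrict Ω) :=
    (hcd.memLp_of_hasCompactSupport hcs).restrict Ω
  have hB : MemLp (fun x => φ x • e) 2 (volume.restrict Ω) :=
    ((hφ.smooth.continuous.smul continuous_const).memLp_of_hasCompactSupport
      hφ.compact.smul_right).restrict Ω
  have key : ∀ p ∈ sobolevZero Ω, inner ℝ p.fst (hA.toLp _) + inner ℝ p.snd (hB.toLp _) = 0 := by
    intro p hp
    have hcl : IsClosed {p : WithLp 2 (Lp ℝ 2 (volume.restrict Ω) ×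
        Lp (Space N) 2 (volume.restrict Ω)) |
        inner ℝ p.fst (hA.toLp _) + inner ℝ p.snd (hB.toLp _) = 0} := by
      refine isClosed_eq ?_ continuous_const
      have h := WithLp.prod_continuous_ofLp 2 (Lp ℝ 2 (volume.restrict Ω))
        (Lp (Space N) 2 (volume.restrict Ω))
      exact ((continuous_fst.comp h).inner continuous_const).add
        ((continuous_snd.comp h).inner continuous_const)
    refine closure_minimal ?_ hcl hp
    rintro p ⟨χ, hχ, h1, h2⟩
    have hχd : Continuous fun x => fderiv ℝ χ x e :=
      (hχ.smooth.continuous_fderiv (by simp)).clm_apply continuous_const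
    have hz : ∀ {f h : Space N → ℝ}, tsupport f ⊆ Ω → ∫ x in Ω, f x * h x = ∫ x, f x * h x := by
      intro f h hf
      refine setIntegral_eq_integral_of_forall_compl_eq_zero fun x hx => ?_
      rw [image_eq_zero_of_notMem_tsupport fun hx' => hx (hf hx'), zero_mul]
    have e1 : inner ℝ p.fst (hA.toLp _) = ∫ x, χ x * fderiv ℝ φ x e := by
      rw [L2.inner_def, ← hz hχ.support_subset]
      refine integral_congr_ae ?_
      filter_upwards [h1, hA.coeFn_toLp] with x hx hx'
      rw [hx, hx']; simp [mul_comm]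
    have e2 : inner ℝ p.snd (hB.toLp _) = ∫ x, fderiv ℝ χ x e * φ x := by
      have : ∫ x, fderiv ℝ χ x e * φ x = ∫ x, φ x * fderiv ℝ χ x e := by simp only [mul_comm]
      rw [L2.inner_def, this, ← hz hφ.support_subset]
      refine integral_congr_ae ?_
      filter_upwards [h2, hB.coeFn_toLp] with x hx hx'
      rw [hx, hx', inner_smul_right]
      simp [gradient]
    have h := integral_mul_fderiv_eq_neg_fderiv_mul_of_integrable (μ := volume) (v := e)
      (f := χ) (g := φ)
      ((hχd.mul hφ.smooth.continuous).integrable_of_hasCompactSupport hφ.compact.mul_left)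
      ((hχ.smooth.continuous.mul hcd).integrable_of_hasCompactSupport hcs.mul_left)
      ((hχ.smooth.continuous.mul hφ.smooth.continuous).integrable_of_hasCompactSupport
        hφ.compact.mul_left)
      (fun x _ => hχ.smooth.differentiable (by simp) x)
      (fun x _ => hφ.smooth.differentiable (by simp) x)
    change inner ℝ p.fst _ + inner ℝ p.snd _ = 0
    rw [e1, e2, h]; ring
  have h := key u.1 u.2
  rw [L2.inner_def, L2.inner_def, add_eq_zero_iff_eq_neg] at h
  have e1 : ∫ x in Ω, u.fn x * fderiv ℝ φ x e =
      ∫ x in Ω, inner ℝ (u.1.fst x) (hA.toLp _ x) := by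
    refine integral_congr_ae ?_
    filter_upwards [hA.coeFn_toLp] with x hx
    rw [hx]; simp [fn, mul_comm]
  have e2 : ∫ x in Ω, φ x * inner ℝ (u.grad x) e =
      ∫ x in Ω, inner ℝ (u.1.snd x) (hB.toLp _ x) := by
    refine integral_congr_ae ?_
    filter_upwards [hB.coeFn_toLp] with x hx
    rw [hx, inner_smul_right]; rfl
  rw [e1, e2, h]

/-- An element of `W^{1,2}_0(Ω)` is determined by its underlying function. -/
theorem ext_fn {Ω : Set (Space N)} (hΩ : IsOpen Ω) {u w : SobolevZero Ω}
    (h : u.fn = w.fn) : u = w := by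
  have hsnd : ∀ e : Space N, ∀ᵐ x ∂volume.restrict Ω,
      inner ℝ (u.grad x) e - inner ℝ (w.grad x) e = 0 := by
    intro e
    have hli : ∀ z : SobolevZero Ω, LocallyIntegrableOn (fun x => inner ℝ (z.grad x) e) Ω := by
      intro z
      rw [locallyIntegrableOn_iff hΩ.isLocallyClosed]
      intro K hK hKc
      have hz : MemLp (fun x => inner ℝ (z.grad x) e) 2 (volume.restrict K) :=
        ((Lp.memLp z.grad).inner_const e).mono_measure (Measure.restrict_mono hK le_rfl)
      have : IsFiniteMeasure (volume.restrict K : Measure (Space N)) :=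
        isFiniteMeasure_restrict.2 hKc.measure_lt_top.ne
      exact hz.integrable (by norm_num)
    rw [ae_restrict_iff' hΩ.measurableSet]
    refine hΩ.ae_eq_zero_of_integral_contDiff_smul_eq_zero ((hli u).sub (hli w)) ?_
    intro φ hφ hφc hφs
    have hφt : IsTest Ω φ := ⟨hφ, hφc, hφs⟩
    have hu := integral_fn_mul_fderiv u hφt e
    have hw := integral_fn_mul_fderiv w hφt e
    rw [h, hw, neg_inj] at hu
    have hint : ∀ z : SobolevZero Ω,
        IntegrableOn (fun x => φ x * inner ℝ (z.grad x) e) Ω := by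
      intro z
      have h1 : MemLp φ 2 (volume.restrict Ω) :=
        (hφ.continuous.memLp_of_hasCompactSupport hφc).restrict Ω
      exact h1.integrable_mul ((Lp.memLp z.grad).inner_const e)
    have hz : ∫ x, φ x • (inner ℝ (u.grad x) e - inner ℝ (w.grad x) e) =
        ∫ x in Ω, φ x * (inner ℝ (u.grad x) e - inner ℝ (w.grad x) e) := by
      symm
      refine setIntegral_eq_integral_of_forall_compl_eq_zero fun x hx => ?_
      rw [image_eq_zero_of_notMem_tsupport fun hx' => hx (hφs hx'), zero_mul]
    refine hz.trans ?_
    simp only [mul_sub]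
    rw [integral_sub (hint u) (hint w), hu, sub_self]
  have hgrad : u.grad = w.grad := by
    refine Lp.ext ?_
    have := ae_all_iff.2 fun i : Fin N => hsnd (EuclideanSpace.single i 1)
    filter_upwards [this] with x hx
    ext i
    have := hx i
    simp only [EuclideanSpace.inner_single_right] at this
    simpa [sub_eq_zero] using this
  exact Subtype.ext (WithLp.ofLp_injective 2 (Prod.ext h hgrad))

end SobolevZero

/-- `f ∈ W^{1,2}_0(Ω)`, for a function `f`. -/
def MemSobolevZero (Ω : Set (Space N)) (f : Space N → ℝ) : Prop :=
  ∃ u : SobolevZero Ω, u.fn =ᵐ[volume.restrict Ω] f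

/-- `v` is a weak solution of the rescaled problem
`∂_t v = ΔΦ(v) + α v` in `Q = Ω × (0,∞)`, `v = 0` on `∂Ω × (0,∞)`, `v(·,0) = u₀`,
where `α = 1/(m-1)`. The integrals over `Q` are iterated ones, so that they depend only on the
classes `v(·,t) ∈ L^{m+1}(Ω)`; only the values of `v` at times `t ≥ 0` matter. -/
structure IsWeakSolution (Ω : Set (Space N)) (m : ℝ) (u₀ : Space N → ℝ)
    (v : ℝ → Space N → ℝ) : Prop where
  /-- `v(·,t) ∈ L^{m+1}(Ω)` for `t ≥ 0` -/
  memLp : ∀ t, 0 ≤ t → MemLp (v t) (ENNReal.ofReal (m + 1)) (volume.restrict Ω)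
  /-- `v ∈ C([0,∞); L^{m+1}(Ω))` -/
  continuous : ∀ s, 0 ≤ s → Tendsto
    (fun t => eLpNorm (v t - v s) (ENNReal.ofReal (m + 1)) (volume.restrict Ω))
    (𝓝[Ici 0] s) (𝓝 0)
  /-- `Φ(v) ∈ L²_loc([0,∞); W^{1,2}_0(Ω))`, and the equation holds against every `η ∈ C_0^∞(Q)` -/
  equation : ∃ w : ℝ → SobolevZero Ω,
    (∀ᵐ t ∂volume.restrict (Ioi (0 : ℝ)),
      (w t).fn =ᵐ[volume.restrict Ω] fun x => Phi m (v t x)) ∧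
    (∀ T : ℝ, 0 < T → MemLp w 2 (volume.restrict (Ioc 0 T))) ∧
    ∀ η : Space N × ℝ → ℝ, IsTest (Ω ×ˢ Ioi (0 : ℝ)) η →
      ∫ t in Ioi (0 : ℝ), ∫ x in Ω,
        (inner ℝ ((w t).grad x) (gradient (fun y => η (y, t)) x)
          - v t x * deriv (fun s => η (x, s)) t)
      = 1 / (m - 1) * ∫ t in Ioi (0 : ℝ), ∫ x in Ω, v t x * η (x, t)
  /-- the initial datum is attained in `L^{m+1}(Ω)` -/
  initial : Tendsto
    (fun t => eLpNorm (v t - u₀) (ENNReal.ofReal (m + 1)) (volume.restrict Ω))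
    (𝓝[>] 0) (𝓝 0)

/-- `∂_t f ∈ L²([T₀,∞); L²(Ω))`: the curve `t ↦ f(·,t)`, with values in `L²(Ω)`, has a weak
derivative `h` on `(T₀,∞)` that lies in this Bochner space. -/
def TimeDerivMemL2L2 (Ω : Set (Space N)) (T₀ : ℝ) (f : ℝ → Space N → ℝ) : Prop :=
  ∃ F h : ℝ → Lp ℝ 2 (volume.restrict Ω),
    (∀ᵐ t ∂volume.restrict (Ioi T₀), F t =ᵐ[volume.restrict Ω] f t) ∧
    LocallyIntegrableOn F (Ioi T₀) ∧
    MemLp h 2 (volume.restrict (Ioi T₀)) ∧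
    ∀ ρ : ℝ → ℝ, IsTest (Ioi T₀) ρ →
      ∫ t in Ioi T₀, deriv ρ t • F t = - ∫ t in Ioi T₀, ρ t • h t

/-- `∇f ∈ L^∞([T₀,∞); L²(Ω))`, for a curve with `f(·,t) ∈ W^{1,2}_0(Ω)` for almost every `t`. -/
def GradMemLinftyL2 (Ω : Set (Space N)) (T₀ : ℝ) (f : ℝ → Space N → ℝ) : Prop :=
  ∃ w : ℝ → SobolevZero Ω,
    (∀ᵐ t ∂volume.restrict (Ioi T₀), (w t).fn =ᵐ[volume.restrict Ω] f t) ∧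
    MemLp (fun t => (w t).grad) ∞ (volume.restrict (Ioi T₀))

/-- The `ω`-limit set in `L^{m+1}(Ω)` of a curve `v` defined for `t ≥ 0`. -/
def omegaLimitSet (Ω : Set (Space N)) (m : ℝ) (v : ℝ → Space N → ℝ) : Set (Space N → ℝ) :=
  {f | MemLp f (ENNReal.ofReal (m + 1)) (volume.restrict Ω) ∧
    ∃ t : ℕ → ℝ, (∀ n, 0 ≤ t n) ∧ Monotone t ∧ Tendsto t atTop atTop ∧
      Tendsto (fun n => eLpNorm (v (t n) - f) (ENNReal.ofReal (m + 1)) (volume.restrict Ω))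
        atTop (𝓝 0)}

/-- `u ∈ W^{1,2}_0(Ω)` is a weak solution of the Lane–Emden equation `-Δu = α |u|^{q-2} u`. -/
def IsLaneEmdenSolution (Ω : Set (Space N)) (q α : ℝ) (u : SobolevZero Ω) : Prop :=
  ∀ φ : SobolevZero Ω, ∫ x in Ω, inner ℝ (u.grad x) (φ.grad x)
    = α * ∫ x in Ω, |u.fn x| ^ (q - 2) * u.fn x * φ.fn x

end

end PorousMedium

namespace PorousMedium

/-! ### The power nonlinearities -/

/-! The mechanism is to average the equation over the moving windows `(t n, t n + 1)` and let `n →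
∞`.

Since `∂_t g(v)` is square integrable in time up to infinity, its integral over windows of bounded
length tends to zero, so `g(v)` becomes almost constant on such windows. The pointwise bound `|a -
b| ^ ((m + 1) / 2) ≤ C * |g a - g b|` transfers this to `v` in `L^{m+1}`. Hence `v (t n + s) → ψ`
uniformly for `s ∈ [0, 1]` (`tendsto_eLpNorm_sub_of_omegaLimit`).

Testing the equation with `φ(x) ρ(τ - t n)`, where `ρ` has unit mass and support in `(0, 1)`, shows
that the average `W n = ∫ ρ(τ - t n) Φ(v(τ)) dτ` solves a Dirichlet problem with datum `∫ (ρ' + α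
ρ)(τ - t n) v(τ) dτ` (`inner_grad_integral_eq`). As `∫ ρ' = 0`, the data converge to `α ψ` in `L²`.
The Poincaré inequality makes the linear Dirichlet problem stable, so `W n` converges strongly in
`W^{1,2}_0` to some `U` with `-ΔU = α ψ` (`exists_tendsto_of_inner_grad_eq`).

Uniform convergence on the windows also gives convergence of `Φ(v)` in `L¹`, which forces `U = Φ(ψ)`
(`ae_eq_Phi_of_tendsto_average`). Since `s ↦ |s|^(q-2) s` inverts `Φ`, the datum `α ψ` is the
Lane–Emden nonlinearity of `U`. -/

/-- Signed powers: `a ↦ |a|^r a` expands distances at least like the power `r + 1`. -/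
theorem abs_sub_rpow_le_signedPow {r : ℝ} (hr : 0 ≤ r) (a b : ℝ) :
    |a - b| ^ (r + 1) ≤ 2 ^ r * |(|a| ^ r * a - |b| ^ r * b)| := by
  have h1 : 1 ≤ r + 1 := by linarith
  have h2r : (1 : ℝ) ≤ 2 ^ r := Real.one_le_rpow (by norm_num) hr
  have hpow : ∀ {x : ℝ}, 0 ≤ x → |x| ^ r * x = x ^ (r + 1) := fun {x} hx => by
    rw [abs_of_nonneg hx, Real.rpow_add_one' hx (by linarith)]
  -- Same sign: superadditivity of the power `r + 1 ≥ 1` gives the bound even with constant one.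
  have nn : ∀ {x y : ℝ}, 0 ≤ y → y ≤ x →
      |x - y| ^ (r + 1) ≤ 2 ^ r * |(|x| ^ r * x - |y| ^ r * y)| := by
    intro x y hy hyx
    have h := Real.add_rpow_le_rpow_add (sub_nonneg.2 hyx) hy h1
    rw [sub_add_cancel] at h
    rw [hpow hy, hpow (hy.trans hyx), abs_of_nonneg (sub_nonneg.2 hyx)]
    have h3 : (x - y) ^ (r + 1) ≤ |x ^ (r + 1) - y ^ (r + 1)| := by
      refine le_trans ?_ (le_abs_self _); linarith
    exact h3.trans (le_mul_of_one_le_left (abs_nonneg _) h2r)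
  -- Opposite signs: the right side is a sum of two powers, and convexity of the power `r + 1`
  -- produces the factor `2 ^ r`.
  have np : ∀ {x y : ℝ}, y ≤ 0 → 0 ≤ x →
      |x - y| ^ (r + 1) ≤ 2 ^ r * |(|x| ^ r * x - |y| ^ r * y)| := by
    intro x y hy hx
    obtain ⟨z, rfl⟩ : ∃ z, y = -z := ⟨-y, by simp⟩
    have hz : 0 ≤ z := by linarith
    have h := NNReal.rpow_add_le_mul_rpow_add_rpow ⟨x, hx⟩ ⟨z, hz⟩ h1
    have h' : (x + z) ^ (r + 1) ≤ 2 ^ r * (x ^ (r + 1) + z ^ (r + 1)) := by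
      have := NNReal.coe_le_coe.2 h
      rw [add_sub_cancel_right] at this
      exact_mod_cast this
    rw [abs_neg, mul_neg, hpow hx, hpow hz, sub_neg_eq_add, sub_neg_eq_add,
      abs_of_nonneg (by positivity), abs_of_nonneg (by positivity)]
    exact h'
  have main : ∀ {x y : ℝ}, y ≤ x →
      |x - y| ^ (r + 1) ≤ 2 ^ r * |(|x| ^ r * x - |y| ^ r * y)| := by
    intro x y hyx
    rcases le_total 0 y with hy | hy
    · exact nn hy hyx
    rcases le_total 0 x with hx | hx
    · exact np hy hx
    have := nn (x := -y) (y := -x) (by linarith) (by linarith)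
    rw [abs_neg, abs_neg] at this
    convert this using 3 <;> ring_nf
  rcases le_total b a with h | h
  · exact main h
  · rw [abs_sub_comm a b, abs_sub_comm (|a| ^ r * a)]
    exact main h

/-- The exponent `(m + 1) / 2` is half of `m + 1`, so that after squaring and integrating, `L²`
distances of `g(v)` control `L^{m+1}` distances of `v`. -/
theorem abs_sub_rpow_le_g {m : ℝ} (hm : 1 ≤ m) (a b : ℝ) :
    |a - b| ^ ((m + 1) / 2) ≤ 2 ^ ((m - 1) / 2) * |g m a - g m b| := by
  have h := abs_sub_rpow_le_signedPow (r := (m - 1) / 2) (by linarith) a b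
  rwa [show (m - 1) / 2 + 1 = (m + 1) / 2 by ring] at h

theorem continuous_Phi {m : ℝ} (hm : 1 ≤ m) : Continuous (Phi m) :=
  (continuous_abs.rpow_const fun _ => Or.inr (by linarith)).mul continuous_id

theorem abs_Phi {m : ℝ} (hm : 0 < m) (s : ℝ) : |Phi m s| = |s| ^ m := by
  rw [Phi, abs_mul, abs_of_nonneg (by positivity)]
  have := Real.rpow_add_one' (abs_nonneg s) (y := m - 1) (by linarith)
  rw [sub_add_cancel] at this
  exact this.symm

theorem Phi_mul (m a b : ℝ) : Phi m (a * b) = Phi m a * Phi m b := by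
  rw [Phi, Phi, Phi, abs_mul, Real.mul_rpow (abs_nonneg a) (abs_nonneg b)]; ring

theorem Phi_one (m : ℝ) : Phi m 1 = 1 := by simp [Phi]

/-- `s ↦ |s|^(q-2) s`, with `q = (m+1)/m`, inverts `Φ`. -/
theorem abs_Phi_rpow_mul_Phi {m : ℝ} (hm : 0 < m) (s : ℝ) :
    |Phi m s| ^ ((m + 1) / m - 2) * Phi m s = s := by
  rcases eq_or_ne s 0 with rfl | hs
  · simp [Phi]
  have hs' : 0 < |s| := abs_pos.2 hs
  rw [abs_Phi hm, ← Real.rpow_mul hs'.le, Phi, ← mul_assoc, ← Real.rpow_add hs',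
    show m * ((m + 1) / m - 2) + (m - 1) = 0 by field_simp; ring, Real.rpow_zero, one_mul]

/-- Modulus of continuity of `Φ`, adapted to `L^m`. -/
theorem exists_abs_Phi_sub_le {m : ℝ} (hm : 1 ≤ m) {ε : ℝ} (hε : 0 < ε) :
    ∃ C : ℝ, 0 ≤ C ∧ ∀ a b : ℝ, |Phi m a - Phi m b| ≤ ε * |b| ^ m + C * |a - b| ^ m := by
  have hm0 : 0 < m := by linarith
  obtain ⟨δ, hδ, h⟩ := Metric.continuousAt_iff.1 ((continuous_Phi hm).continuousAt (x := (1 : ℝ)))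
    ε hε
  -- `Φ` is multiplicative, so for `|a - b| < δ |b|` continuity at `1` applied to `a / b` gives the
  -- term with `ε`. Otherwise `|a|` and `|b|` are at most `(1 + 1 / δ) |a - b|` and `(1 / δ) |a -
  -- b|`, and the two summands of `C` bound `|Φ a|` and `|Φ b|` separately.
  refine ⟨(1 + 1 / δ) ^ m + (1 / δ) ^ m, by positivity, fun a b => ?_⟩
  by_cases hab : |a - b| < δ * |b|
  · have hb : b ≠ 0 := by
      rintro rfl
      simp at hab
      exact absurd hab (not_lt.2 (abs_nonneg a))
    have hb' : 0 < |b| := abs_pos.2 hb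
    have hx : dist (a / b) 1 < δ := by
      rw [Real.dist_eq, div_sub_one hb, abs_div, div_lt_iff₀ hb']
      exact hab
    have h' := (h hx).le
    rw [Real.dist_eq, Phi_one] at h'
    have ha : Phi m a = Phi m b * Phi m (a / b) := by
      rw [← Phi_mul, mul_div_cancel₀ a hb]
    have e : Phi m a - Phi m b = Phi m b * (Phi m (a / b) - 1) := by rw [ha]; ring
    rw [e, abs_mul, abs_Phi hm0, mul_comm]
    have : 0 ≤ ((1 + 1 / δ) ^ m + (1 / δ) ^ m) * |a - b| ^ m := by positivity
    have := mul_le_mul_of_nonneg_right h' (by positivity : 0 ≤ |b| ^ m)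
    linarith
  · have hb : |b| ≤ 1 / δ * |a - b| := by
      rw [one_div, inv_mul_eq_div, le_div_iff₀ hδ, mul_comm]
      exact not_lt.1 hab
    have ha : |a| ≤ (1 + 1 / δ) * |a - b| := by
      have := abs_add_le (a - b) b
      rw [sub_add_cancel] at this
      linarith
    have hb' := Real.rpow_le_rpow (abs_nonneg b) hb hm0.le
    have ha' := Real.rpow_le_rpow (abs_nonneg a) ha hm0.le
    rw [Real.mul_rpow (by positivity) (abs_nonneg _)] at ha' hb'
    have h1 : |Phi m a - Phi m b| ≤ |a| ^ m + |b| ^ m := by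
      rw [← abs_Phi hm0, ← abs_Phi hm0]; exact abs_sub _ _
    have h2 : 0 ≤ ε * |b| ^ m := by positivity
    linarith

/-! ### Curves with a weak derivative -/

/-- A smooth approximation of the Heaviside function with derivative a given bump function. -/
theorem exists_contDiff_deriv_eq_normed (φ : ContDiffBump (0 : ℝ)) (hφ : φ.rOut < 1) :
    ∃ Ψ : ℝ → ℝ, ContDiff ℝ ∞ Ψ ∧ (∀ x, HasDerivAt Ψ (φ.normed volume x) x) ∧ Monotone Ψ ∧
      (∀ x ≤ -φ.rOut, Ψ x = 0) ∧ ∀ x, φ.rOut ≤ x → Ψ x = 1 := by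
  set κ := φ.normed volume with hκ
  have hc : Continuous κ := φ.continuous_normed
  have hz : ∀ x, φ.rOut ≤ |x| → κ x = 0 := fun x hx => by
    have : x ∉ Function.support κ := by
      rw [hκ, φ.support_normed_eq]; simpa using hx
    simpa using this
  have hd : ∀ x, HasDerivAt (fun x => ∫ y in (-1 : ℝ)..x, κ y) (κ x) x := fun x =>
    intervalIntegral.integral_hasDerivAt_right (hc.intervalIntegrable _ _)
      (hc.stronglyMeasurableAtFilter _ _) hc.continuousAt
  have hpos := φ.rOut_pos
  -- The base point `-1` lies to the left of the support of the bump, because its outer radius is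
  -- less than `1`.
  refine ⟨fun x => ∫ y in (-1 : ℝ)..x, κ y, ?_, hd, ?_, ?_, ?_⟩
  · rw [contDiff_infty_iff_deriv]
    refine ⟨fun x => (hd x).differentiableAt, ?_⟩
    rw [show deriv (fun x => ∫ y in (-1 : ℝ)..x, κ y) = κ from funext fun x => (hd x).deriv]
    exact φ.contDiff_normed
  · refine monotone_of_deriv_nonneg (fun x => (hd x).differentiableAt) fun x => ?_
    rw [(hd x).deriv]; exact φ.nonneg_normed x
  · intro x hx
    refine (intervalIntegral.integral_congr (g := fun _ => (0 : ℝ)) fun y hy => ?_).trans (by simp)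
    refine hz y ?_
    have h1 := hy.2
    have : y ≤ -φ.rOut := h1.trans (sup_le (by linarith) hx)
    rw [abs_of_nonpos (by linarith)]; linarith
  · intro x hx
    change ∫ y in (-1 : ℝ)..x, κ y = 1
    rw [intervalIntegral.integral_of_le (by linarith)]
    refine Eq.trans ?_ (φ.integral_normed (μ := volume))
    refine setIntegral_eq_integral_of_forall_compl_eq_zero fun y hy => hz y ?_
    rcases le_or_gt y (-1) with h | h
    · rw [abs_of_nonpos (by linarith)]; linarith
    · have : x < y := by
        by_contra hc
        exact hy ⟨h, not_lt.1 hc⟩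
      exact (hx.trans this.le).trans (le_abs_self y)

/-- A curve whose weak derivative on `(T₀,∞)` is `h` has increments controlled by `∫ ‖h‖`, off a
null set of times. -/
theorem exists_norm_sub_le_integral_weakDeriv {E : Type*} [NormedAddCommGroup E] [NormedSpace ℝ E]
    [CompleteSpace E] {T₀ : ℝ} {F h : ℝ → E} (hF : LocallyIntegrableOn F (Ioi T₀))
    (hh : LocallyIntegrableOn h (Ioi T₀))
    (hw : ∀ ρ : ℝ → ℝ, IsTest (Ioi T₀) ρ →
      ∫ t in Ioi T₀, deriv ρ t • F t = - ∫ t in Ioi T₀, ρ t • h t) :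
    ∃ S : Set ℝ, (∀ᵐ t, t ∈ S) ∧ ∀ s ∈ S, ∀ t ∈ S, T₀ + 1 < s → s ≤ t →
      ‖F t - F s‖ ≤ ∫ r in Icc (s - 1 / 2) (t + 1 / 2), ‖h r‖ := by
  -- Convolution needs local integrability on all of `ℝ`, and `F` may blow up at `T₀`. Cutting at
  -- `T₀ + 1 / 2` changes no mollification of radius at most `1 / 2` at a point beyond `T₀ + 1`.
  set F' : ℝ → E := (Ici (T₀ + 1 / 2)).indicator F with hF'
  have hF'i : LocallyIntegrable F' := by
    rw [locallyIntegrable_iff]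
    intro K hK
    rw [hF', IntegrableOn, integrable_indicator_iff measurableSet_Ici, IntegrableOn,
      Measure.restrict_restrict measurableSet_Ici]
    refine hF.integrableOn_compact_subset ?_ (hK.inter_left isClosed_Ici)
    rintro x ⟨hx, -⟩
    have : T₀ + 1 / 2 ≤ x := hx
    change T₀ < x
    linarith
  have hbpos : ∀ i : ℕ, 0 < 1 / (4 * ((i : ℝ) + 1)) := fun i => by positivity
  let φ : ℕ → ContDiffBump (0 : ℝ) := fun i =>
    ⟨1 / (4 * ((i : ℝ) + 1)), 2 * (1 / (4 * ((i : ℝ) + 1))), hbpos i, by linarith [hbpos i]⟩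
  have hφle : ∀ i, (φ i).rOut ≤ 1 / 2 := fun i => by
    change 2 * (1 / (4 * ((i : ℝ) + 1))) ≤ 1 / 2
    have : (0 : ℝ) ≤ i := i.cast_nonneg
    rw [mul_one_div, div_le_div_iff₀ (by positivity) (by norm_num)]
    linarith
  have hφ0 : Tendsto (fun i => (φ i).rOut) atTop (𝓝 0) := by
    have := (tendsto_one_div_add_atTop_nhds_zero_nat (𝕜 := ℝ)).const_mul (1 / 2)
    rw [mul_zero] at this
    refine this.congr fun i => ?_
    change _ = 2 * (1 / (4 * ((i : ℝ) + 1)))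
    field_simp; norm_num
  -- `K` bounds the ratio of outer to inner radius, which is exactly `2` for this family.
  have hae := ContDiffBump.ae_convolution_tendsto_right_of_locallyIntegrable (K := 2) hφ0
    (Eventually.of_forall fun i => le_rfl) hF'i
  refine ⟨{x₀ | Tendsto (fun i => (convolution ((φ i).normed volume) F'
    (ContinuousLinearMap.lsmul ℝ ℝ) volume) x₀) atTop (𝓝 (F' x₀))}, hae,
    fun s hs t ht hTs hst => ?_⟩
  rw [mem_ofPred_eq] at hs ht
  have hFeq : ∀ x, T₀ + 1 < x → F' x = F x := fun x hx =>
    indicator_of_mem (mem_Ici.2 (by linarith)) F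
  have hz : ∀ i x, 1 / 2 ≤ |x| → (φ i).normed volume x = 0 := fun i x hx => by
    have : x ∉ Function.support ((φ i).normed volume) := by
      rw [(φ i).support_normed_eq]; simpa using (hφle i).trans hx
    simpa using this
  have hconv : ∀ i x, T₀ + 1 < x →
      (convolution ((φ i).normed volume) F' (ContinuousLinearMap.lsmul ℝ ℝ) volume) x
        = ∫ τ in Ioi T₀, (φ i).normed volume (τ - x) • F τ := by
    intro i x hx
    rw [convolution_eq_swap, ← setIntegral_eq_integral_of_forall_compl_eq_zero (s := Ioi T₀)]
    · refine setIntegral_congr_fun measurableSet_Ioi fun τ hτ => ?_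
      simp only [ContinuousLinearMap.lsmul_apply]
      rw [← neg_sub τ x, ContDiffBump.normed_neg]
      by_cases h : T₀ + 1 / 2 ≤ τ
      · rw [hF', indicator_of_mem (by exact h)]
      · rw [hz i (τ - x), zero_smul, zero_smul]
        rw [abs_of_nonpos (by linarith)]; linarith
    · intro τ hτ
      have : F' τ = 0 := indicator_of_notMem (fun h => hτ (by
        have : T₀ + 1 / 2 ≤ τ := h
        change T₀ < τ
        linarith)) F
      simp [this]
  have hint : ∀ i x, T₀ + 1 < x →
      IntegrableOn (fun τ => (φ i).normed volume (τ - x) • F τ) (Ioi T₀) := by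
    intro i x hx
    have hK : IntegrableOn F (Icc (x - 1 / 2) (x + 1 / 2)) :=
      hF.integrableOn_compact_subset (fun y hy => by
        have := hy.1
        change T₀ < y
        linarith) isCompact_Icc
    have h1 : IntegrableOn (fun τ => (φ i).normed volume (τ - x) • F τ)
        (Icc (x - 1 / 2) (x + 1 / 2)) := hK.continuousOn_smul
      ((φ i).continuous_normed.comp (continuous_id.sub continuous_const)).continuousOn isCompact_Icc
    refine ((integrableOn_iff_integrable_of_support_subset fun τ hτ => ?_).1 h1).integrableOn
    by_contra hτ'
    refine hτ ?_
    change (φ i).normed volume (τ - x) • F τ = 0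
    rw [hz i, zero_smul]
    by_contra hc
    rw [not_le, abs_lt] at hc
    exact hτ' ⟨by linarith, by linarith⟩
  have hTt : T₀ + 1 < t := hTs.trans_le hst
  have hhi : IntegrableOn (fun r => ‖h r‖) (Icc (s - 1 / 2) (t + 1 / 2)) :=
    (hh.integrableOn_compact_subset (fun y hy => by
        have := hy.1
        change T₀ < y
        linarith) isCompact_Icc).norm
  have hbound : ∀ i,
      ‖(convolution ((φ i).normed volume) F' (ContinuousLinearMap.lsmul ℝ ℝ) volume) t
        - (convolution ((φ i).normed volume) F' (ContinuousLinearMap.lsmul ℝ ℝ) volume) s‖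
      ≤ ∫ r in Icc (s - 1 / 2) (t + 1 / 2), ‖h r‖ := by
    intro i
    obtain ⟨Ψ, hΨs, hΨd, hΨm, hΨ0, hΨ1⟩ := exists_contDiff_deriv_eq_normed (φ i)
      ((hφle i).trans_lt (by norm_num))
    have hri := hφle i
    have h01 : ∀ x, 0 ≤ Ψ x ∧ Ψ x ≤ 1 := fun x => by
      constructor
      · rw [← hΨ0 (min x (-(φ i).rOut)) (min_le_right _ _)]; exact hΨm (min_le_left _ _)
      · rw [← hΨ1 (max x ((φ i).rOut)) (le_max_right _ _)]; exact hΨm (le_max_left _ _)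
    -- A smoothed indicator of `[s, t]`: its derivative is the difference of the mollifiers at `s`
    -- and `t`, so testing with it gives the increment of the mollified curve. Its values lie in
    -- `[-1, 1]` and its support in `[s - 1 / 2, t + 1 / 2]`.
    set ρ : ℝ → ℝ := fun τ => Ψ (τ - s) - Ψ (τ - t) with hρ
    have hρd : ∀ τ, deriv ρ τ = (φ i).normed volume (τ - s) - (φ i).normed volume (τ - t) :=
      fun τ => (((hΨd (τ - s)).comp_sub_const τ s).sub ((hΨd (τ - t)).comp_sub_const τ t)).deriv
    have hρz : ∀ τ, τ ∉ Icc (s - 1 / 2) (t + 1 / 2) → ρ τ = 0 := by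
      intro τ hτ
      rcases lt_or_ge τ (s - 1 / 2) with h | h
      · simp only [hρ]
        rw [hΨ0 (τ - s) (by linarith), hΨ0 (τ - t) (by linarith), sub_zero]
      · have : t + 1 / 2 < τ := by
          by_contra hc
          exact hτ ⟨h, not_lt.1 hc⟩
        simp only [hρ]
        rw [hΨ1 (τ - s) (by linarith), hΨ1 (τ - t) (by linarith), sub_self]
    have hts : tsupport ρ ⊆ Icc (s - 1 / 2) (t + 1 / 2) :=
      closure_minimal (fun τ hτ => by
        by_contra hc
        exact hτ (hρz τ hc)) isClosed_Icc
    have htest : IsTest (Ioi T₀) ρ := by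
      refine ⟨(hΨs.comp (contDiff_id.sub contDiff_const)).sub
        (hΨs.comp (contDiff_id.sub contDiff_const)),
        isCompact_Icc.of_isClosed_subset (isClosed_tsupport _) hts, fun τ hτ => ?_⟩
      have := (hts hτ).1
      change T₀ < τ
      linarith
    have h := hw ρ htest
    simp only [hρd, sub_smul] at h
    rw [integral_sub (hint i s hTs) (hint i t hTt), ← hconv i s hTs, ← hconv i t hTt] at h
    have hsub : Icc (s - 1 / 2) (t + 1 / 2) ⊆ Ioi T₀ := fun y hy => by
      have := hy.1
      change T₀ < y
      linarith
    rw [norm_sub_rev, h, norm_neg, ← inter_eq_right.2 hsub,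
      ← setIntegral_indicator measurableSet_Icc]
    refine norm_integral_le_of_norm_le (hhi.integrable_indicator measurableSet_Icc).integrableOn
      (Eventually.of_forall fun τ => ?_)
    by_cases hτ : τ ∈ Icc (s - 1 / 2) (t + 1 / 2)
    · rw [indicator_of_mem hτ, norm_smul]
      refine mul_le_of_le_one_left (norm_nonneg _) ?_
      rw [Real.norm_eq_abs, abs_le]
      have := h01 (τ - s)
      have := h01 (τ - t)
      simp only [hρ]
      constructor <;> linarith
    · rw [indicator_of_notMem hτ, hρz τ hτ, zero_smul, norm_zero]
  have hlim := (ht.sub hs).norm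
  rw [hFeq s hTs, hFeq t hTt] at hlim
  exact le_of_tendsto hlim (Eventually.of_forall hbound)

variable {N : ℕ}

/-! ### The Poincaré inequality -/

theorem IsTest.continuous_gradient {Ω : Set (Space N)} {φ : Space N → ℝ} (hφ : IsTest Ω φ) :
    Continuous (gradient φ) :=
  (InnerProductSpace.toDual ℝ (Space N)).symm.continuous.comp
    (hφ.smooth.continuous_fderiv (by simp))

theorem IsTest.hasCompactSupport_gradient {Ω : Set (Space N)} {φ : Space N → ℝ}
    (hφ : IsTest Ω φ) : HasCompactSupport (gradient φ) :=
  (hφ.compact.fderiv (𝕜 := ℝ)).comp_left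
    (g := (InnerProductSpace.toDual ℝ (Space N)).symm) (map_zero _)

/-- With `L x = ⟨e, x⟩`, so that `∂_e L = 1`, integration by parts gives `∫ χ² = -2 ∫ L χ ∂_e χ`.
Young's inequality bounds the right side by `1 / 2 ∫ χ² + 2 R² ∫ |∇χ|²`, and absorbing the first
term yields `4 R²`. -/
theorem IsTest.integral_sq_le {Ω : Set (Space N)} {χ : Space N → ℝ} (hχ : IsTest Ω χ) {R : ℝ}
    (hR : ∀ x ∈ Ω, ‖x‖ ≤ R) {e : Space N} (he : ‖e‖ = 1) :
    ∫ x in Ω, χ x ^ 2 ≤ 4 * R ^ 2 * ∫ x in Ω, ‖gradient χ x‖ ^ 2 := by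
  have hχd : Continuous fun x => fderiv ℝ χ x e :=
    (hχ.smooth.continuous_fderiv (by simp)).clm_apply continuous_const
  have hχc := hχ.smooth.continuous
  obtain ⟨L, hLe, hLx⟩ : ∃ L : Space N →L[ℝ] ℝ, L e = 1 ∧ ∀ x, |L x| ≤ ‖x‖ :=
    ⟨innerSL ℝ e, by simp [he], fun x => by simpa [he] using abs_real_inner_le_norm e x⟩
  have hdiff : Differentiable ℝ χ := hχ.smooth.differentiable (by simp)
  have hfd : ∀ x, fderiv ℝ (fun x => L x * χ x) x e = χ x + L x * fderiv ℝ χ x e := by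
    intro x
    rw [fderiv_fun_mul L.differentiableAt (hdiff x)]
    simp [hLe]
    ring
  have i1 : Integrable fun x => χ x ^ 2 :=
    (hχc.pow 2).integrable_of_hasCompactSupport
      (by simpa only [sq] using hχ.compact.mul_left (f := χ))
  have i2 : Integrable fun x => L x * χ x * fderiv ℝ χ x e := by
    have hc : HasCompactSupport fun x => L x * χ x := hχ.compact.mul_left
    exact ((L.continuous.mul hχc).mul hχd).integrable_of_hasCompactSupport hc.mul_right
  have i3 : Integrable fun x => ‖gradient χ x‖ ^ 2 := by
    have hc : HasCompactSupport fun x => ‖gradient χ x‖ := hχ.hasCompactSupport_gradient.norm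
    refine (hχ.continuous_gradient.norm.pow 2).integrable_of_hasCompactSupport ?_
    simpa only [sq] using hc.mul_left (f := fun x => ‖gradient χ x‖)
  have ibp := integral_mul_fderiv_eq_neg_fderiv_mul_of_integrable (μ := volume) (v := e)
      (f := fun x => L x * χ x) (g := χ)
      (by
        refine (i1.add i2).congr (Eventually.of_forall fun x => ?_)
        simp only [hfd, Pi.add_apply]; ring)
      i2
      (((L.continuous.mul hχc).mul hχc).integrable_of_hasCompactSupport hχ.compact.mul_left)
      (fun x _ => L.differentiableAt.mul (hdiff x)) (fun x _ => hdiff x)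
  have e1 : ∫ x, fderiv ℝ (fun x => L x * χ x) x e * χ x
      = (∫ x, χ x ^ 2) + ∫ x, L x * χ x * fderiv ℝ χ x e := by
    rw [← integral_add i1 i2]
    refine integral_congr_ae (Eventually.of_forall fun x => ?_)
    simp only [hfd]; ring
  rw [e1] at ibp
  have hle : ∫ x, -(2 * (L x * χ x * fderiv ℝ χ x e))
      ≤ ∫ x, (1 / 2 * χ x ^ 2 + 2 * R ^ 2 * ‖gradient χ x‖ ^ 2) := by
    refine integral_mono (i2.const_mul 2).neg ((i1.const_mul _).add (i3.const_mul _)) fun x => ?_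
    change -(2 * (L x * χ x * fderiv ℝ χ x e)) ≤ 1 / 2 * χ x ^ 2 + 2 * R ^ 2 * ‖gradient χ x‖ ^ 2
    by_cases hx : x ∈ Ω
    · have h1 : |L x| ≤ R := (hLx x).trans (hR x hx)
      have h2 : |fderiv ℝ χ x e| ≤ ‖gradient χ x‖ := by
        have : fderiv ℝ χ x e = inner ℝ (gradient χ x) e := by simp [gradient]
        rw [this]
        simpa [he] using abs_real_inner_le_norm (gradient χ x) e
      have h3 : |L x * fderiv ℝ χ x e| ≤ R * ‖gradient χ x‖ := by
        rw [abs_mul]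
        exact mul_le_mul h1 h2 (abs_nonneg _) ((abs_nonneg _).trans h1)
      have h4 : (L x * fderiv ℝ χ x e) ^ 2 ≤ (R * ‖gradient χ x‖) ^ 2 := by
        rw [← sq_abs]; gcongr
      nlinarith [sq_nonneg (χ x + 2 * (L x * fderiv ℝ χ x e))]
    · rw [image_eq_zero_of_notMem_tsupport fun hx' => hx (hχ.support_subset hx')]
      simp only [mul_zero, zero_mul, neg_zero]
      positivity
  rw [integral_neg, integral_const_mul, integral_add (i1.const_mul _) (i3.const_mul _),
    integral_const_mul, integral_const_mul] at hle
  have z1 : ∫ x in Ω, χ x ^ 2 = ∫ x, χ x ^ 2 := by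
    refine setIntegral_eq_integral_of_forall_compl_eq_zero fun x hx => ?_
    rw [image_eq_zero_of_notMem_tsupport fun hx' => hx (hχ.support_subset hx')]
    exact zero_pow two_ne_zero
  have z2 : ∫ x in Ω, ‖gradient χ x‖ ^ 2 = ∫ x, ‖gradient χ x‖ ^ 2 := by
    refine setIntegral_eq_integral_of_forall_compl_eq_zero fun x hx => ?_
    have : gradient χ x = 0 := by
      rw [gradient, image_eq_zero_of_notMem_tsupport fun hx' =>
        hx (hχ.support_subset (tsupport_fderiv_subset ℝ hx')), map_zero]
    rw [this, norm_zero]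
    exact zero_pow two_ne_zero
  rw [z1, z2]
  linarith

theorem continuous_fst_withLp (Ω : Set (Space N)) : Continuous fun p : WithLp 2
    (Lp ℝ 2 (volume.restrict Ω) × Lp (Space N) 2 (volume.restrict Ω)) => p.fst :=
  continuous_fst.comp (WithLp.prod_continuous_ofLp 2 _ _)

theorem continuous_snd_withLp (Ω : Set (Space N)) : Continuous fun p : WithLp 2
    (Lp ℝ 2 (volume.restrict Ω) × Lp (Space N) 2 (volume.restrict Ω)) => p.snd :=
  continuous_snd.comp (WithLp.prod_continuous_ofLp 2 _ _)

namespace SobolevZero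

/-- The inequality is a closed condition on the pair of function and gradient, so it passes from
test functions to their closure. The assumption `1 ≤ N` provides a unit vector. -/
theorem exists_norm_fn_le (hN : 1 ≤ N) {Ω : Set (Space N)} (hΩb : Bornology.IsBounded Ω) :
    ∃ C : ℝ, 0 ≤ C ∧ ∀ u : SobolevZero Ω, ‖u.fn‖ ≤ C * ‖u.grad‖ := by
  obtain ⟨R, hR0, hR⟩ := hΩb.exists_pos_norm_le
  refine ⟨2 * R, by positivity, fun u => ?_⟩
  have hcl : IsClosed {p : WithLp 2 (Lp ℝ 2 (volume.restrict Ω) ×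
      Lp (Space N) 2 (volume.restrict Ω)) | ‖p.fst‖ ≤ 2 * R * ‖p.snd‖} :=
    isClosed_le (continuous_fst_withLp Ω).norm
      (continuous_const.mul (continuous_snd_withLp Ω).norm)
  refine closure_minimal ?_ hcl u.2
  rintro p ⟨χ, hχ, h1, h2⟩
  have h := hχ.integral_sq_le hR (e := EuclideanSpace.single ⟨0, hN⟩ 1) (by simp)
  have e1 : ‖p.fst‖ ^ 2 = ∫ x in Ω, χ x ^ 2 := by
    rw [← real_inner_self_eq_norm_sq, L2.inner_def]
    refine integral_congr_ae ?_
    filter_upwards [h1] with x hx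
    rw [hx, real_inner_self_eq_norm_sq, Real.norm_eq_abs, sq_abs]
  have e2 : ‖p.snd‖ ^ 2 = ∫ x in Ω, ‖gradient χ x‖ ^ 2 := by
    rw [← real_inner_self_eq_norm_sq, L2.inner_def]
    refine integral_congr_ae ?_
    filter_upwards [h2] with x hx
    rw [hx, real_inner_self_eq_norm_sq]
  rw [← e1, ← e2] at h
  refine (sq_le_sq₀ (norm_nonneg _) (by positivity)).1 ?_
  rw [mul_pow, mul_pow]
  linarith

/-! ### The inclusion and gradient maps, and density of test functions -/

/-- The inclusion `W^{1,2}_0(Ω) → L²(Ω)`. -/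
noncomputable def fnL (Ω : Set (Space N)) : SobolevZero Ω →L[ℝ] Lp ℝ 2 (volume.restrict Ω) where
  toFun := fn
  map_add' _ _ := rfl
  map_smul' _ _ := rfl
  cont := (continuous_fst_withLp Ω).comp continuous_subtype_val

/-- The gradient `W^{1,2}_0(Ω) → L²(Ω;ℝ^N)`. -/
noncomputable def gradL (Ω : Set (Space N)) :
    SobolevZero Ω →L[ℝ] Lp (Space N) 2 (volume.restrict Ω) where
  toFun := grad
  map_add' _ _ := rfl
  map_smul' _ _ := rfl
  cont := (continuous_snd_withLp Ω).comp continuous_subtype_val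

instance (Ω : Set (Space N)) : CompleteSpace (SobolevZero Ω) :=
  inferInstanceAs (CompleteSpace (testGraph Ω).topologicalClosure)

theorem norm_le_add {Ω : Set (Space N)} (u : SobolevZero Ω) : ‖u‖ ≤ ‖u.fn‖ + ‖u.grad‖ := by
  have h : ‖u‖ ^ 2 = ‖u.fn‖ ^ 2 + ‖u.grad‖ ^ 2 := WithLp.prod_norm_sq_eq_of_L2 u.1
  refine (sq_le_sq₀ (norm_nonneg _) (by positivity)).1 ?_
  nlinarith [norm_nonneg u.fn, norm_nonneg u.grad]

/-- The element of `W^{1,2}_0(Ω)` given by a test function. -/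
theorem exists_of_isTest {Ω : Set (Space N)} {φ : Space N → ℝ} (hφ : IsTest Ω φ) :
    ∃ u : SobolevZero Ω, u.fn =ᵐ[volume.restrict Ω] φ ∧
      u.grad =ᵐ[volume.restrict Ω] gradient φ := by
  have h1 : MemLp φ 2 (volume.restrict Ω) :=
    (hφ.smooth.continuous.memLp_of_hasCompactSupport hφ.compact).restrict Ω
  have h2 : MemLp (gradient φ) 2 (volume.restrict Ω) :=
    (hφ.continuous_gradient.memLp_of_hasCompactSupport hφ.hasCompactSupport_gradient).restrict Ω
  refine ⟨⟨WithLp.toLp 2 (h1.toLp φ, h2.toLp _), subset_closure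
    ⟨φ, hφ, h1.coeFn_toLp, h2.coeFn_toLp⟩⟩, h1.coeFn_toLp, h2.coeFn_toLp⟩

/-- A closed condition on `W^{1,2}_0(Ω)` may be checked on test functions. -/
theorem induction_isTest {Ω : Set (Space N)} {P : SobolevZero Ω → Prop}
    (hP : IsClosed {u | P u})
    (h : ∀ (u : SobolevZero Ω) (φ : Space N → ℝ), IsTest Ω φ → u.fn =ᵐ[volume.restrict Ω] φ →
      u.grad =ᵐ[volume.restrict Ω] gradient φ → P u) (u : SobolevZero Ω) : P u := by
  have hd : Dense {u : SobolevZero Ω | u.1 ∈ testGraph Ω} := by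
    rw [Subtype.dense_iff]
    intro x hx
    refine closure_mono ?_ (show x ∈ closure (testGraph Ω : Set _) from hx)
    intro y hy
    exact ⟨⟨y, subset_closure hy⟩, hy, rfl⟩
  have := hd.closure_eq.symm.subset (mem_univ u)
  refine closure_minimal ?_ hP this
  rintro u ⟨φ, hφ, h1, h2⟩
  exact h u φ hφ h1 h2

end SobolevZero

/-- Almost everywhere equality of integrable functions, tested against `C_0^∞(Ω)`. -/
theorem ae_eq_of_integral_mul_isTest {Ω : Set (Space N)} (hΩ : IsOpen Ω) {f k : Space N → ℝ}
    (hf : IntegrableOn f Ω) (hk : IntegrableOn k Ω)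
    (h : ∀ χ, IsTest Ω χ → ∫ x in Ω, χ x * f x = ∫ x in Ω, χ x * k x) :
    f =ᵐ[volume.restrict Ω] k := by
  have := hΩ.ae_eq_zero_of_integral_contDiff_smul_eq_zero (μ := volume)
    (hf.sub hk).locallyIntegrableOn (fun χ h1 h2 h3 => by
      have hi : ∀ {z : Space N → ℝ}, IntegrableOn z Ω → IntegrableOn (fun x => χ x * z x) Ω := by
        intro z hz
        obtain ⟨B, hB⟩ := h2.exists_bound_of_continuous h1.continuous
        exact hz.bdd_mul h1.continuous.aestronglyMeasurable (Eventually.of_forall hB)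
      rw [← setIntegral_eq_integral_of_forall_compl_eq_zero (s := Ω) fun x hx => by
        rw [image_eq_zero_of_notMem_tsupport fun hx' => hx (h3 hx'), zero_smul]]
      simp only [Pi.sub_apply, smul_eq_mul, mul_sub]
      rw [integral_sub (hi hf) (hi hk), h χ ⟨h1, h2, h3⟩, sub_self])
  filter_upwards [(ae_restrict_iff' hΩ.measurableSet).2 this] with x hx
  simpa [sub_eq_zero] using hx

/-! ### Convergence in Lebesgue spaces -/

section Lebesgue

variable {X : Type*} [MeasurableSpace X] {μ : Measure X} {ι : Type*} {l : Filter ι}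

/-- On a finite measure space, convergence in `L^q` implies convergence in `L^p`, for `p ≤ q`. -/
theorem tendsto_eLpNorm_of_le [IsFiniteMeasure μ] {p q : ℝ≥0∞} (hp : p ≠ 0) (hpq : p ≤ q)
    {f : ι → X → ℝ} (hf : ∀ᶠ i in l, AEStronglyMeasurable (f i) μ)
    (h : Tendsto (fun i => eLpNorm (f i) q μ) l (𝓝 0)) :
    Tendsto (fun i => eLpNorm (f i) p μ) l (𝓝 0) := by
  set K := μ univ ^ (1 / p.toReal - 1 / q.toReal) with hK
  have hKt : K ≠ ⊤ := by
    refine ENNReal.rpow_ne_top_of_nonneg ?_ (measure_ne_top _ _)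
    rcases eq_or_ne q ⊤ with rfl | hq
    · simp
    · rw [sub_nonneg]
      exact one_div_le_one_div_of_le (ENNReal.toReal_pos hp (ne_top_of_le_ne_top hq hpq))
        (ENNReal.toReal_mono hq hpq)
  have h' := ENNReal.Tendsto.mul_const h (Or.inr hKt)
  rw [zero_mul] at h'
  refine tendsto_of_tendsto_of_tendsto_of_le_of_le' tendsto_const_nhds h'
    (Eventually.of_forall fun _ => zero_le) ?_
  filter_upwards [hf] with i hi
  exact eLpNorm_le_eLpNorm_mul_rpow_measure_univ hpq hi

theorem tendsto_Lp_two_of_tendsto_eLpNorm [IsFiniteMeasure μ] {q : ℝ≥0∞} (hq : 2 ≤ q)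
    {V : ι → Lp ℝ 2 μ} {W : Lp ℝ 2 μ} {f : ι → X → ℝ} {k : X → ℝ}
    (hV : ∀ᶠ i in l, V i =ᵐ[μ] f i) (hW : W =ᵐ[μ] k)
    (h : Tendsto (fun i => eLpNorm (f i - k) q μ) l (𝓝 0)) : Tendsto V l (𝓝 W) := by
  have h2 := tendsto_eLpNorm_of_le (p := 2) (by norm_num) hq (l := l) (by
    filter_upwards [hV] with i hi
    exact ((Lp.aestronglyMeasurable (V i)).congr hi).sub
      ((Lp.aestronglyMeasurable W).congr hW)) h
  rw [tendsto_iff_edist_tendsto_0]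
  refine h2.congr' ?_
  filter_upwards [hV] with i hi
  rw [Lp.edist_def]
  exact eLpNorm_congr_ae (hi.sub hW).symm

/-- Integrating `exists_abs_Phi_sub_le` bounds the `L¹` distance by `r ‖k‖_m^m + C ‖f i - k‖_m^m`.
The first term is small by the choice of `r`; the second tends to zero, as `L^{m+1}` convergence
implies `L^m` convergence on a finite measure space. -/
theorem tendsto_eLpNorm_Phi_sub [IsFiniteMeasure μ] {m : ℝ} (hm : 1 ≤ m)
    {f : ι → X → ℝ} {k : X → ℝ} (hk : MemLp k (ENNReal.ofReal (m + 1)) μ)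
    (hf : ∀ᶠ i in l, AEStronglyMeasurable (f i) μ)
    (h : Tendsto (fun i => eLpNorm (f i - k) (ENNReal.ofReal (m + 1)) μ) l (𝓝 0)) :
    Tendsto (fun i => eLpNorm (fun x => Phi m (f i x) - Phi m (k x)) 1 μ) l (𝓝 0) := by
  have hm0 : 0 < m := by linarith
  have hle : ENNReal.ofReal m ≤ ENNReal.ofReal (m + 1) := ENNReal.ofReal_le_ofReal (by linarith)
  have hd : Tendsto (fun i => eLpNorm (f i - k) (ENNReal.ofReal m) μ) l (𝓝 0) :=
    tendsto_eLpNorm_of_le (by simpa using hm0) hle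
      (hf.mono fun i hi => hi.sub hk.aestronglyMeasurable) h
  have hd' : Tendsto (fun i => eLpNorm (f i - k) (ENNReal.ofReal m) μ ^ m) l (𝓝 0) := by
    have := (ENNReal.continuous_rpow_const (y := m)).tendsto 0 |>.comp hd
    rwa [ENNReal.zero_rpow_of_pos hm0] at this
  set M := eLpNorm k (ENNReal.ofReal m) μ ^ m with hM
  have hMt : M ≠ ⊤ := ENNReal.rpow_ne_top_of_nonneg hm0.le (hk.mono_exponent hle).eLpNorm_ne_top
  refine tendsto_order.2 ⟨fun a ha => absurd ha not_lt_zero, fun ε hε => ?_⟩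
  obtain ⟨r, hr, hr0⟩ : ∃ r : ℝ, ENNReal.ofReal r * M < ε ∧ 0 < r := by
    have h0 : Tendsto (fun r : ℝ => ENNReal.ofReal r * M) (𝓝[>] 0) (𝓝 0) := by
      have := ENNReal.Tendsto.mul_const (b := M) (ENNReal.continuous_ofReal.tendsto 0)
        (Or.inr hMt)
      rw [ENNReal.ofReal_zero, zero_mul] at this
      exact this.mono_left nhdsWithin_le_nhds
    exact ((h0.eventually (gt_mem_nhds hε)).and self_mem_nhdsWithin).exists
  obtain ⟨C, hC0, hC⟩ := exists_abs_Phi_sub_le hm hr0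
  have hlim : Tendsto (fun i => ENNReal.ofReal r * M +
      ENNReal.ofReal C * eLpNorm (f i - k) (ENNReal.ofReal m) μ ^ m) l
      (𝓝 (ENNReal.ofReal r * M)) := by
    have := (ENNReal.Tendsto.const_mul (a := ENNReal.ofReal C) hd'
      (Or.inr ENNReal.ofReal_ne_top)).const_add (ENNReal.ofReal r * M)
    simpa using this
  filter_upwards [hlim.eventually (gt_mem_nhds hr), hf] with i hi hfi
  refine lt_of_le_of_lt ?_ hi
  have hpow : ∀ {z : X → ℝ}, eLpNorm (fun x => ‖z x‖ ^ m) 1 μ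
      = eLpNorm z (ENNReal.ofReal m) μ ^ m := fun {z} => by
    rw [eLpNorm_norm_rpow z hm0, one_mul]
  have hmeas : ∀ {z : X → ℝ}, AEStronglyMeasurable z μ →
      AEStronglyMeasurable (fun x => ‖z x‖ ^ m) μ := fun {z} hz =>
    (continuous_norm.rpow_const fun _ => Or.inr hm0.le).comp_aestronglyMeasurable hz
  calc eLpNorm (fun x => Phi m (f i x) - Phi m (k x)) 1 μ
      ≤ eLpNorm (r • (fun x => ‖k x‖ ^ m) + C • (fun x => ‖(f i - k) x‖ ^ m)) 1 μ := by
        refine eLpNorm_mono_real fun x => ?_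
        exact hC (f i x) (k x)
    _ ≤ eLpNorm (r • (fun x => ‖k x‖ ^ m)) 1 μ + eLpNorm (C • (fun x => ‖(f i - k) x‖ ^ m)) 1 μ :=
        eLpNorm_add_le ((hmeas hk.aestronglyMeasurable).const_smul _)
          ((hmeas (hfi.sub hk.aestronglyMeasurable)).const_smul _) le_rfl
    _ = _ := by
        rw [eLpNorm_const_smul, eLpNorm_const_smul, hpow, hpow, Real.enorm_eq_ofReal hr0.le,
          Real.enorm_eq_ofReal hC0]

theorem integrable_Phi [IsFiniteMeasure μ] {m : ℝ} (hm : 1 ≤ m) {k : X → ℝ}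
    (hk : MemLp k (ENNReal.ofReal (m + 1)) μ) : Integrable (fun x => Phi m (k x)) μ := by
  have hm0 : 0 < m := by linarith
  have h := (hk.mono_exponent (p := ENNReal.ofReal m)
    (ENNReal.ofReal_le_ofReal (by linarith))).integrable_norm_rpow (by simpa using hm0)
    ENNReal.ofReal_ne_top
  rw [ENNReal.toReal_ofReal hm0.le] at h
  refine h.mono' ((continuous_Phi hm).comp_aestronglyMeasurable hk.aestronglyMeasurable)
    (Eventually.of_forall fun x => ?_)
  rw [Real.norm_eq_abs, abs_Phi hm0, Real.norm_eq_abs]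

/-- The left side is the `L²` norm of `|f - k| ^ ((m + 1) / 2)`, so the pointwise bound
`abs_sub_rpow_le_g` can be integrated directly. -/
theorem eLpNorm_rpow_le_of_ae_eq_g {m : ℝ} (hm : 1 ≤ m) {F G : Lp ℝ 2 μ} {f k : X → ℝ}
    (hF : F =ᵐ[μ] fun x => g m (f x)) (hG : G =ᵐ[μ] fun x => g m (k x)) :
    eLpNorm (f - k) (ENNReal.ofReal (m + 1)) μ ^ ((m + 1) / 2)
      ≤ ENNReal.ofReal (2 ^ ((m - 1) / 2) * ‖F - G‖) := by
  have hp : ENNReal.ofReal (m + 1) = 2 * ENNReal.ofReal ((m + 1) / 2) := by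
    rw [show (2 : ℝ≥0∞) = ENNReal.ofReal 2 by simp, ← ENNReal.ofReal_mul (by norm_num)]
    congr 1; ring
  rw [hp, ← eLpNorm_norm_rpow _ (by linarith), ENNReal.ofReal_mul (by positivity),
    ofReal_norm, Lp.enorm_def]
  refine eLpNorm_le_mul_eLpNorm_of_ae_le_mul ?_ 2
  filter_upwards [hF, hG, Lp.coeFn_sub F G] with x h1 h2 h3
  rw [h3, Pi.sub_apply, Pi.sub_apply, h1, h2, Real.norm_eq_abs, abs_of_nonneg (by positivity)]
  exact abs_sub_rpow_le_g hm (f x) (k x)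

end Lebesgue

/-! ### Asymptotic behaviour in time -/

/-- The integrals of an `L²` curve over windows of fixed length tend to zero. -/
theorem exists_integral_norm_le_of_memLp_two {E : Type*} [NormedAddCommGroup E] {T₀ L ε : ℝ}
    (hL : 0 < L) (hε : 0 < ε) {h : ℝ → E} (hh : MemLp h 2 (volume.restrict (Ioi T₀))) :
    ∃ A, T₀ ≤ A ∧ ∀ a b, A < a → b ≤ a + L → ∫ r in Icc a b, ‖h r‖ ≤ ε := by
  have hi : IntegrableOn (fun r => ‖h r‖ ^ 2) (Ioi T₀) := hh.norm.integrable_sq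
  -- Weighted Young: `‖h‖ ≤ δ + ‖h‖² / (4 δ)`. Over a window of length at most `L` the constant
  -- contributes `L δ = ε / 2`; a tail of `∫ ‖h‖²` below `2 δ ε` makes the other term at most `ε /
  -- 2`.
  set δ := ε / (2 * L) with hδ
  have hδ0 : 0 < δ := by positivity
  have hlim := intervalIntegral_tendsto_integral_Ioi T₀ hi tendsto_id
  have hlt : (∫ x in Ioi T₀, ‖h x‖ ^ 2) - 2 * δ * ε < ∫ x in Ioi T₀, ‖h x‖ ^ 2 := by
    have : 0 < 2 * δ * ε := by positivity
    linarith
  obtain ⟨A, hA, hTA⟩ := ((hlim.eventually (lt_mem_nhds hlt)).and (eventually_ge_atTop T₀)).exists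
  simp only [id] at hA
  have hiA : IntegrableOn (fun r => ‖h r‖ ^ 2) (Ioi A) := hi.mono_set (Ioi_subset_Ioi hTA)
  rw [← intervalIntegral.integral_interval_add_Ioi hi hiA] at hA
  refine ⟨A, hTA, fun a b ha hb => ?_⟩
  have hsub : Icc a b ⊆ Ioi A := fun x hx => ha.trans_le hx.1
  have hib := hiA.mono_set hsub
  have hvol : volume.real (Icc a b) ≤ L := by
    rw [Measure.real, Real.volume_Icc]
    exact ENNReal.toReal_le_of_le_ofReal hL.le (ENNReal.ofReal_le_ofReal (by linarith))
  have hc : IntegrableOn (fun _ : ℝ => δ) (Icc a b) := integrableOn_const measure_Icc_lt_top.ne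
  have h1 : ∫ r in Icc a b, ‖h r‖ ≤ ∫ r in Icc a b, (δ + 1 / (4 * δ) * ‖h r‖ ^ 2) := by
    refine integral_mono_of_nonneg (Eventually.of_forall fun _ => norm_nonneg _)
      (hc.add (hib.const_mul _)) (Eventually.of_forall fun r => ?_)
    change ‖h r‖ ≤ δ + 1 / (4 * δ) * ‖h r‖ ^ 2
    have : δ + 1 / (4 * δ) * ‖h r‖ ^ 2 - ‖h r‖ = 1 / (4 * δ) * (‖h r‖ - 2 * δ) ^ 2 := by
      field_simp; ring
    have h0 : 0 ≤ 1 / (4 * δ) * (‖h r‖ - 2 * δ) ^ 2 := by positivity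
    linarith
  have h2 : ∫ r in Icc a b, ‖h r‖ ^ 2 ≤ ∫ r in Ioi A, ‖h r‖ ^ 2 :=
    setIntegral_mono_set hiA (Eventually.of_forall fun _ => by positivity)
      (Eventually.of_forall hsub)
  rw [integral_add hc (hib.const_mul _), integral_const_mul, setIntegral_const, smul_eq_mul] at h1
  have h3 : volume.real (Icc a b) * δ ≤ ε / 2 := by
    calc volume.real (Icc a b) * δ ≤ L * δ := by gcongr
      _ = ε / 2 := by rw [hδ]; field_simp
  have h4 : 1 / (4 * δ) * ∫ r in Icc a b, ‖h r‖ ^ 2 ≤ ε / 2 := by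
    calc 1 / (4 * δ) * ∫ r in Icc a b, ‖h r‖ ^ 2 ≤ 1 / (4 * δ) * (2 * δ * ε) := by
          gcongr; linarith
      _ = ε / 2 := by field_simp; norm_num
  linarith

namespace IsWeakSolution

variable {Ω : Set (Space N)} {m : ℝ} {u₀ : Space N → ℝ} {v : ℝ → Space N → ℝ}

/-- If `∂_t g(v) ∈ L²([T₀,∞); L²(Ω))`, then `v` oscillates less and less on time intervals of unit
length. -/
theorem exists_eLpNorm_sub_le (hm : 1 ≤ m) (hv : IsWeakSolution Ω m u₀ v) {T₀ : ℝ} (hT₀ : 0 < T₀)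
    (hg : TimeDerivMemL2L2 Ω T₀ (fun t x => g m (v t x))) {ε : ℝ≥0∞} (hε : 0 < ε) :
    ∃ A, 0 < A ∧ ∀ s t, A ≤ s → s ≤ t → t ≤ s + 1 →
      eLpNorm (v t - v s) (ENNReal.ofReal (m + 1)) (volume.restrict Ω) ≤ ε := by
  obtain ⟨F, h, hFv, hFi, hh, hw⟩ := hg
  have hhi : LocallyIntegrableOn h (Ioi T₀) := by
    rw [locallyIntegrableOn_iff isOpen_Ioi.isLocallyClosed]
    intro K hK hKc
    have : IsFiniteMeasure (volume.restrict K : Measure ℝ) :=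
      isFiniteMeasure_restrict.2 hKc.measure_lt_top.ne
    exact (hh.mono_measure (Measure.restrict_mono hK le_rfl)).integrable (by norm_num)
  obtain ⟨S, hSae, hS⟩ := exists_norm_sub_le_integral_weakDeriv hFi hhi hw
  rw [ae_restrict_iff' measurableSet_Ioi] at hFv
  have hdense := Measure.dense_of_ae (hSae.and hFv)
  obtain ⟨r, hr0, hr⟩ : ∃ r : ℝ, 0 < r ∧ ENNReal.ofReal r ≤ ε / 2 := by
    have h2 : 0 < ε / 2 := ENNReal.half_pos hε.ne'
    rcases eq_or_ne (ε / 2) ⊤ with h | h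
    · exact ⟨1, one_pos, h ▸ le_top⟩
    · exact ⟨(ε / 2).toReal, ENNReal.toReal_pos h2.ne' h, (ENNReal.ofReal_toReal h).le⟩
  set c : ℝ := 2 ^ ((m - 1) / 2) with hc
  have hc0 : 0 < c := by positivity
  -- Length `3` accommodates `[s - 1 / 2, t + 1 / 2]` with `t ≤ s + 2`.
  obtain ⟨A, hTA, hA⟩ := exists_integral_norm_le_of_memLp_two (L := 3) (by norm_num)
    (show 0 < r ^ ((m + 1) / 2) / c by positivity) hh
  have hp : 0 < (m + 1) / 2 := by linarith
  have good : ∀ s t, s ∈ {x | x ∈ S ∧ (x ∈ Ioi T₀ → F x =ᵐ[volume.restrict Ω]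
      fun y => g m (v x y))} → t ∈ {x | x ∈ S ∧ (x ∈ Ioi T₀ → F x =ᵐ[volume.restrict Ω]
      fun y => g m (v x y))} → A + 1 < s → s ≤ t → t ≤ s + 2 →
      eLpNorm (v t - v s) (ENNReal.ofReal (m + 1)) (volume.restrict Ω) ≤ ε / 2 := by
    intro s t hs ht hAs hst hts
    have h1 := hS s hs.1 t ht.1 (by linarith) hst
    have h2 := hA (s - 1 / 2) (t + 1 / 2) (by linarith) (by linarith)
    have h3 := eLpNorm_rpow_le_of_ae_eq_g hm (ht.2 (mem_Ioi.2 (by linarith)))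
      (hs.2 (mem_Ioi.2 (by linarith)))
    refine le_trans ((ENNReal.rpow_le_rpow_iff hp).1 (h3.trans ?_)) hr
    rw [ENNReal.ofReal_rpow_of_pos hr0]
    refine ENNReal.ofReal_le_ofReal ?_
    have := mul_le_mul_of_nonneg_left (h1.trans h2) hc0.le
    rwa [mul_div_cancel₀ _ hc0.ne'] at this
  have good' : ∀ s t, s ∈ {x | x ∈ S ∧ (x ∈ Ioi T₀ → F x =ᵐ[volume.restrict Ω]
      fun y => g m (v x y))} → t ∈ {x | x ∈ S ∧ (x ∈ Ioi T₀ → F x =ᵐ[volume.restrict Ω]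
      fun y => g m (v x y))} → A + 1 < s → A + 1 < t → |t - s| ≤ 2 →
      eLpNorm (v t - v s) (ENNReal.ofReal (m + 1)) (volume.restrict Ω) ≤ ε / 2 := by
    intro s t hs ht hAs hAt hts
    rw [abs_le] at hts
    rcases le_total s t with hst | hst
    · exact good s t hs ht hAs hst (by linarith)
    · rw [eLpNorm_sub_comm]
      exact good t s ht hs hAt hst (by linarith)
  have h4 : 0 < ε / 2 / 2 := ENNReal.half_pos (ENNReal.half_pos hε.ne').ne'
  -- The increment bound holds only off a null set of times. That set has dense complement, so
  -- continuity of `v` in `L^{m+1}` replaces any time by a good one slightly to its right.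
  have near : ∀ s, A + 1 < s → ∃ s' ∈ {x | x ∈ S ∧ (x ∈ Ioi T₀ → F x =ᵐ[volume.restrict Ω]
      fun y => g m (v x y))}, s < s' ∧ s' < s + 1 ∧
      eLpNorm (v s' - v s) (ENNReal.ofReal (m + 1)) (volume.restrict Ω) ≤ ε / 2 / 2 := by
    intro s hs
    have hev := (ENNReal.tendsto_nhds_zero.1 (hv.continuous s (by linarith))) _ h4
    rw [nhdsWithin_eq_nhds.2 (Ici_mem_nhds (by linarith))] at hev
    obtain ⟨δ, hδ, hball⟩ := Metric.eventually_nhds_iff.1 hev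
    obtain ⟨s', hs', h1, h2⟩ := hdense.exists_between
      (show s < s + min δ 1 by have := lt_min hδ one_pos; linarith)
    refine ⟨s', hs', h1, h2.trans_le (by have := min_le_right δ 1; linarith), hball ?_⟩
    rw [Real.dist_eq, abs_of_pos (by linarith)]
    have := min_le_left δ 1
    linarith
  -- For `s ≤ t ≤ s + 1` the good times `s'`, `t'` satisfy `|t' - s'| ≤ 2`; the three errors are `ε
  -- / 4`, `ε / 2` and `ε / 4`.
  refine ⟨A + 2, by linarith, fun s t hs hst hts => ?_⟩
  obtain ⟨s', hs', h1, h2, h3⟩ := near s (by linarith)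
  obtain ⟨t', ht', h1', h2', h3'⟩ := near t (by linarith)
  have h5 := good' s' t' hs' ht' (by linarith) (by linarith)
    (abs_le.2 ⟨by linarith, by linarith⟩)
  have hmeas : ∀ x, 0 ≤ x → AEStronglyMeasurable (v x) (volume.restrict Ω) := fun x hx =>
    (hv.memLp x hx).aestronglyMeasurable
  have ms := hmeas s (by linarith)
  have mt := hmeas t (by linarith)
  have ms' := hmeas s' (by linarith)
  have mt' := hmeas t' (by linarith)
  have hone : 1 ≤ ENNReal.ofReal (m + 1) := by
    rw [ENNReal.one_le_ofReal]; linarith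
  have e : v t - v s = (v t - v t') + ((v t' - v s') + (v s' - v s)) := by abel
  rw [e]
  refine (eLpNorm_add_le (mt.sub mt') ((mt'.sub ms').add (ms'.sub ms)) hone).trans ?_
  refine (add_le_add le_rfl (eLpNorm_add_le (mt'.sub ms') (ms'.sub ms) hone)).trans ?_
  rw [eLpNorm_sub_comm (v t)]
  refine (add_le_add h3' (add_le_add h5 h3)).trans (le_of_eq ?_)
  rw [add_left_comm, ENNReal.add_halves, ENNReal.add_halves]

/-- Along a sequence of times giving an `ω`-limit point, `v` converges to it uniformly on time
intervals of unit length. -/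
theorem tendsto_eLpNorm_sub_of_omegaLimit (hm : 1 ≤ m) (hv : IsWeakSolution Ω m u₀ v) {T₀ : ℝ}
    (hT₀ : 0 < T₀) (hg : TimeDerivMemL2L2 Ω T₀ (fun t x => g m (v t x))) {ψ : Space N → ℝ}
    (hψ : MemLp ψ (ENNReal.ofReal (m + 1)) (volume.restrict Ω)) {t : ℕ → ℝ} (ht0 : ∀ n, 0 ≤ t n)
    (ht : Tendsto t atTop atTop)
    (htψ : Tendsto (fun n => eLpNorm (v (t n) - ψ) (ENNReal.ofReal (m + 1)) (volume.restrict Ω))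
      atTop (𝓝 0)) :
    Tendsto (fun p : ℕ × ℝ => eLpNorm (v (t p.1 + p.2) - ψ) (ENNReal.ofReal (m + 1))
      (volume.restrict Ω)) (atTop ×ˢ 𝓟 (Icc 0 1)) (𝓝 0) := by
  refine ENNReal.tendsto_nhds_zero.2 fun ε hε => ?_
  have h2 : 0 < ε / 2 := ENNReal.half_pos hε.ne'
  obtain ⟨A, -, hA⟩ := hv.exists_eLpNorm_sub_le hm hT₀ hg h2
  rw [eventually_prod_principal_iff]
  filter_upwards [ht.eventually_ge_atTop A, (ENNReal.tendsto_nhds_zero.1 htψ) _ h2] with n h3 h4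
  rintro s ⟨hs0, hs1⟩
  have h5 := hA (t n) (t n + s) h3 (by linarith) (by linarith)
  have e : v (t n + s) - ψ = (v (t n + s) - v (t n)) + (v (t n) - ψ) := by abel
  have m1 := (hv.memLp (t n) (ht0 n)).aestronglyMeasurable
  have m2 := (hv.memLp (t n + s) (add_nonneg (ht0 n) hs0)).aestronglyMeasurable
  change eLpNorm (v (t n + s) - ψ) _ _ ≤ ε
  rw [e]
  refine (eLpNorm_add_le (m2.sub m1) (m1.sub hψ.aestronglyMeasurable)
    (by rw [ENNReal.one_le_ofReal]; linarith)).trans ?_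
  exact (add_le_add h5 h4).trans (ENNReal.add_halves ε).le

end IsWeakSolution

/-- Averages of a curve over translates of a fixed kernel, when the translated curves converge
uniformly on the support of the kernel. -/
theorem tendsto_integral_translate_smul {E : Type*} [NormedAddCommGroup E] [NormedSpace ℝ E]
    [CompleteSpace E] {κ : ℝ → ℝ} (hκ : Continuous κ) (hκ0 : ∀ s, s ∉ Ioo (0 : ℝ) 1 → κ s = 0)
    {J : ℝ → E} (hJ : AEStronglyMeasurable J (volume.restrict (Ioi 0))) {t : ℕ → ℝ}
    (ht : ∀ n, 0 ≤ t n) {z : E}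
    (hJz : Tendsto (fun p : ℕ × ℝ => J (t p.1 + p.2)) (atTop ×ˢ 𝓟 (Icc 0 1)) (𝓝 z)) :
    Tendsto (fun n => ∫ τ in Ioi (0 : ℝ), κ (τ - t n) • J τ) atTop (𝓝 ((∫ s, κ s) • z)) := by
  have hcs : HasCompactSupport κ := HasCompactSupport.intro (isCompact_Icc (a := (0 : ℝ)) (b := 1))
    fun s hs => hκ0 s fun h => hs (Ioo_subset_Icc_self h)
  have hκi : Integrable κ := hκ.integrable_of_hasCompactSupport hcs
  have hκn : ∀ n, Integrable fun τ => κ (τ - t n) := fun n => hκi.comp_sub_right (t n)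
  have hout : ∀ n τ, τ ∉ Ioi (0 : ℝ) → κ (τ - t n) = 0 := fun n τ hτ => hκ0 _ fun h => hτ (by
    have := h.1
    have := ht n
    change 0 < τ
    linarith)
  have hconst : ∀ n, ∫ τ in Ioi (0 : ℝ), κ (τ - t n) • z = (∫ s, κ s) • z := fun n => by
    rw [integral_smul_const, setIntegral_eq_integral_of_forall_compl_eq_zero (hout n),
      integral_sub_right_eq_self κ (t n)]
  have hI : 0 ≤ ∫ s, |κ s| := integral_nonneg fun _ => abs_nonneg _
  rw [Metric.tendsto_nhds]
  intro ε hε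
  -- The `+ 1` keeps the denominator positive when `κ` vanishes identically.
  set r := ε / 2 / ((∫ s, |κ s|) + 1) with hr
  have hr0 : 0 < r := by positivity
  have hev := Metric.tendsto_nhds.1 hJz r hr0
  rw [eventually_prod_principal_iff] at hev
  filter_upwards [hev] with n hn
  have hb : ∀ τ, ‖κ (τ - t n) • (J τ - z)‖ ≤ |κ (τ - t n)| * r := by
    intro τ
    by_cases h : τ - t n ∈ Ioo (0 : ℝ) 1
    · rw [norm_smul, Real.norm_eq_abs]
      have := hn (τ - t n) (Ioo_subset_Icc_self h)
      simp only [add_sub_cancel, dist_eq_norm] at this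
      gcongr
    · rw [hκ0 _ h]; simp
  have hbi : Integrable (fun τ => |κ (τ - t n)| * r) (volume.restrict (Ioi 0)) :=
    ((hκn n).abs.mul_const r).integrableOn
  -- `J` is only assumed measurable; for these `n`, integrability follows from its closeness to `z`
  -- on the support of the translated kernel.
  have hdi : Integrable (fun τ => κ (τ - t n) • (J τ - z)) (volume.restrict (Ioi 0)) :=
    hbi.mono' ((hκ.comp (continuous_id.sub continuous_const)).aestronglyMeasurable.smul
      (hJ.sub aestronglyMeasurable_const)) (Eventually.of_forall hb)
  have hzi : Integrable (fun τ => κ (τ - t n) • z) (volume.restrict (Ioi 0)) :=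
    ((hκn n).smul_const z).integrableOn
  have e : ∫ τ in Ioi (0 : ℝ), κ (τ - t n) • J τ
      = (∫ τ in Ioi (0 : ℝ), κ (τ - t n) • (J τ - z)) + (∫ s, κ s) • z := by
    rw [← hconst n, ← integral_add hdi hzi]
    refine integral_congr_ae (Eventually.of_forall fun τ => ?_)
    simp [smul_sub]
  rw [dist_eq_norm, e, add_sub_cancel_right]
  refine (norm_integral_le_of_norm_le hbi (Eventually.of_forall hb)).trans_lt ?_
  rw [setIntegral_eq_integral_of_forall_compl_eq_zero fun τ hτ => by rw [hout n τ hτ]; simp,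
    integral_mul_const, integral_sub_right_eq_self (fun s => |κ s|) (t n)]
  have : (∫ s, |κ s|) * r ≤ ε / 2 := by
    rw [hr, mul_div_assoc', div_le_iff₀ (by positivity)]
    nlinarith
  linarith

/-! ### Time averages -/

theorem integrableOn_Ioi_smul {E : Type*} [NormedAddCommGroup E] [NormedSpace ℝ E] {κ : ℝ → ℝ}
    (hκ : Continuous κ) (hκc : HasCompactSupport κ) {J : ℝ → E}
    (hJ : ∀ T, 0 < T → IntegrableOn J (Ioc 0 T)) : IntegrableOn (fun τ => κ τ • J τ) (Ioi 0) := by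
  obtain ⟨T, hT0, hT⟩ := hκc.isCompact.isBounded.exists_pos_norm_le
  have h1 : IntegrableOn (fun τ => κ τ • J τ) (Icc 0 T) :=
    ((integrableOn_Icc_iff_integrableOn_Ioc).2 (hJ T hT0)).continuousOn_smul
      hκ.continuousOn isCompact_Icc
  refine h1.of_forall_sdiff_eq_zero measurableSet_Ioi fun τ hτ => ?_
  have hτ0 : 0 < τ := hτ.1
  have : τ ∉ tsupport κ := fun h => hτ.2 ⟨hτ0.le, (le_abs_self τ).trans (hT τ h)⟩
  rw [image_eq_zero_of_notMem_tsupport this, zero_smul]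

theorem IsTest.deriv_continuous {U : Set ℝ} {σ : ℝ → ℝ} (hσ : IsTest U σ) :
    Continuous (deriv σ) :=
  hσ.smooth.continuous_deriv (by simp)

/-- The product `φ(x) σ(t)` of test functions is a test function. -/
theorem IsTest.prod_mul {Ω : Set (Space N)} {I : Set ℝ} {φ : Space N → ℝ} {σ : ℝ → ℝ}
    (hφ : IsTest Ω φ) (hσ : IsTest I σ) :
    IsTest (Ω ×ˢ I) (fun p : Space N × ℝ => φ p.1 * σ p.2) := by
  have hsub : tsupport (fun p : Space N × ℝ => φ p.1 * σ p.2) ⊆ tsupport φ ×ˢ tsupport σ := by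
    refine closure_minimal (fun p hp => ?_) ((isClosed_tsupport _).prod (isClosed_tsupport _))
    exact ⟨subset_tsupport _ (left_ne_zero_of_mul hp), subset_tsupport _ (right_ne_zero_of_mul hp)⟩
  exact ⟨(hφ.smooth.comp contDiff_fst).mul (hσ.smooth.comp contDiff_snd),
    (hφ.compact.isCompact.prod hσ.compact.isCompact).of_isClosed_subset (isClosed_tsupport _) hsub,
    hsub.trans (prod_mono hφ.support_subset hσ.support_subset)⟩

/-- Weighted time averages of a weak solution solve an elliptic equation. -/
theorem inner_grad_integral_eq {Ω : Set (Space N)} {α : ℝ} {v : ℝ → Space N → ℝ}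
    {w : ℝ → SobolevZero Ω} (hw : ∀ T : ℝ, 0 < T → MemLp w 2 (volume.restrict (Ioc 0 T)))
    (heq : ∀ η : Space N × ℝ → ℝ, IsTest (Ω ×ˢ Ioi (0 : ℝ)) η →
      ∫ t in Ioi (0 : ℝ), ∫ x in Ω,
        (inner ℝ ((w t).grad x) (gradient (fun y => η (y, t)) x)
          - v t x * deriv (fun s => η (x, s)) t)
      = α * ∫ t in Ioi (0 : ℝ), ∫ x in Ω, v t x * η (x, t))
    {V : ℝ → Lp ℝ 2 (volume.restrict Ω)} (hVc : ContinuousOn V (Ici 0))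
    (hV : ∀ t, 0 ≤ t → V t =ᵐ[volume.restrict Ω] v t) {σ : ℝ → ℝ} (hσ : IsTest (Ioi 0) σ)
    (u : SobolevZero Ω) :
    inner ℝ (SobolevZero.grad (∫ t in Ioi (0 : ℝ), σ t • w t)) u.grad
      = inner ℝ (∫ t in Ioi (0 : ℝ), (deriv σ t + α * σ t) • V t) u.fn := by
  have hσc := hσ.smooth.continuous
  have hiw : IntegrableOn (fun t => σ t • w t) (Ioi 0) :=
    integrableOn_Ioi_smul hσc hσ.compact fun T hT => (hw T hT).integrable (by norm_num)
  have hiV : ∀ {κ : ℝ → ℝ}, Continuous κ → HasCompactSupport κ →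
      IntegrableOn (fun t => κ t • V t) (Ioi 0) := fun h1 h2 =>
    integrableOn_Ioi_smul h1 h2 fun T _ =>
      ((hVc.mono Icc_subset_Ici_self).integrableOn_compact isCompact_Icc).mono_set
        Ioc_subset_Icc_self
  have i1 := hiV hσ.deriv_continuous hσ.compact.deriv
  have i2 := hiV hσc hσ.compact
  -- Both sides are continuous in `u`, so it suffices to take a test function `φ` and use the
  -- separated function `φ(x) σ(t)` in the equation.
  refine SobolevZero.induction_isTest (P := fun u => inner ℝ (SobolevZero.grad
    (∫ t in Ioi (0 : ℝ), σ t • w t)) u.grad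
      = inner ℝ (∫ t in Ioi (0 : ℝ), (deriv σ t + α * σ t) • V t) u.fn) ?_ ?_ u
  · exact isClosed_eq (continuous_const.inner (SobolevZero.gradL Ω).continuous)
      (continuous_const.inner (SobolevZero.fnL Ω).continuous)
  intro u φ hφ h1 h2
  have hL : inner ℝ (SobolevZero.grad (∫ t in Ioi (0 : ℝ), σ t • w t)) u.grad
      = ∫ t in Ioi (0 : ℝ), σ t * inner ℝ (w t).grad u.grad := by
    have := ContinuousLinearMap.integral_comp_comm
      ((innerSL ℝ u.grad).comp (SobolevZero.gradL Ω)) hiw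
    rw [real_inner_comm]
    refine this.symm.trans (integral_congr_ae (Eventually.of_forall fun t => ?_))
    change inner ℝ u.grad (SobolevZero.gradL Ω (σ t • w t)) = _
    rw [map_smul, inner_smul_right, real_inner_comm]
    rfl
  have hR : ∀ {κ : ℝ → ℝ}, IntegrableOn (fun t => κ t • V t) (Ioi 0) →
      inner ℝ (∫ t in Ioi (0 : ℝ), κ t • V t) u.fn
      = ∫ t in Ioi (0 : ℝ), κ t * inner ℝ (V t) u.fn := by
    intro κ hκ
    rw [real_inner_comm, ← integral_inner hκ]
    refine integral_congr_ae (Eventually.of_forall fun t => ?_)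
    simp only
    rw [inner_smul_right, real_inner_comm]
  have hsplit : ∫ t in Ioi (0 : ℝ), (deriv σ t + α * σ t) • V t
      = (∫ t in Ioi (0 : ℝ), deriv σ t • V t) + α • ∫ t in Ioi (0 : ℝ), σ t • V t := by
    rw [← integral_smul]
    refine Eq.trans ?_ (integral_add i1 (i2.smul α))
    refine integral_congr_ae (Eventually.of_forall fun t => ?_)
    simp [add_smul, mul_smul]
  have hfn : ∀ t, 0 ≤ t → ∫ x in Ω, v t x * φ x = inner ℝ (V t) u.fn := fun t ht => by
    rw [L2.inner_def]
    refine integral_congr_ae ?_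
    filter_upwards [hV t ht, h1] with x hx hx'
    rw [hx, hx']; simp [mul_comm]
  have hgr : ∀ t, ∫ x in Ω, inner ℝ ((w t).grad x) (gradient φ x) = inner ℝ (w t).grad u.grad :=
    fun t => by
    rw [L2.inner_def]
    refine integral_congr_ae ?_
    filter_upwards [h2] with x hx
    rw [hx]
  have hvi : ∀ t, 0 ≤ t → IntegrableOn (fun x => v t x * φ x) Ω := fun t ht => by
    refine (L2.integrable_inner (𝕜 := ℝ) (V t) u.fn).congr ?_
    filter_upwards [hV t ht, h1] with x hx hx'
    rw [hx, hx']; simp [mul_comm]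
  have hgi : ∀ t, IntegrableOn (fun x => inner ℝ ((w t).grad x) (gradient φ x)) Ω := fun t => by
    refine (L2.integrable_inner (𝕜 := ℝ) (w t).grad u.grad).congr ?_
    filter_upwards [h2] with x hx
    rw [hx]
  have h := heq _ (hφ.prod_mul hσ)
  have hl : ∀ t ∈ Ioi (0 : ℝ), ∫ x in Ω,
        (inner ℝ ((w t).grad x) (gradient (fun y => φ y * σ t) x)
          - v t x * deriv (fun s => φ x * σ s) t)
      = σ t * inner ℝ (w t).grad u.grad - deriv σ t * inner ℝ (V t) u.fn := by
    intro t ht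
    rw [← hgr t, ← hfn t (le_of_lt ht), ← integral_const_mul, ← integral_const_mul,
      ← integral_sub ((hgi t).const_mul _) ((hvi t (le_of_lt ht)).const_mul _)]
    refine integral_congr_ae (Eventually.of_forall fun x => ?_)
    have e1 : gradient (fun y => φ y * σ t) x = σ t • gradient φ x := by
      rw [← gradient_smul_test hφ.smooth]
      congr 1
      ext y
      simp [mul_comm]
    have e2 : deriv (fun s => φ x * σ s) t = φ x * deriv σ t :=
      deriv_const_mul _ (hσ.smooth.differentiable (by simp) t)
    simp only [e1, e2, inner_smul_right]
    ring
  have hr : ∀ t ∈ Ioi (0 : ℝ), ∫ x in Ω, v t x * (φ x * σ t) = σ t * inner ℝ (V t) u.fn := by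
    intro t ht
    rw [← hfn t (le_of_lt ht), ← integral_const_mul]
    refine integral_congr_ae (Eventually.of_forall fun x => ?_)
    simp only
    ring
  rw [setIntegral_congr_fun measurableSet_Ioi hl, setIntegral_congr_fun measurableSet_Ioi hr] at h
  have j1 : IntegrableOn (fun t => σ t * inner ℝ (w t).grad u.grad) (Ioi 0) := by
    refine (((innerSL ℝ u.grad).comp (SobolevZero.gradL Ω)).integrable_comp hiw).congr
      (Eventually.of_forall fun t => ?_)
    change inner ℝ u.grad (SobolevZero.gradL Ω (σ t • w t)) = _
    rw [map_smul, inner_smul_right, real_inner_comm]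
    rfl
  have j2 : IntegrableOn (fun t => deriv σ t * inner ℝ (V t) u.fn) (Ioi 0) := by
    refine (i1.inner_const u.fn).congr (Eventually.of_forall fun t => ?_)
    exact real_inner_smul_left _ _ _
  rw [integral_sub j1 j2] at h
  rw [hL, hsplit, inner_add_left, inner_smul_left, hR i1, hR i2]
  simp only [conj_trivial]
  linarith

/-! ### Stability of the Dirichlet problem -/

namespace SobolevZero

/-- Energy estimate: testing with `z` itself and applying Poincaré gives `‖∇z‖² ≤ C ‖f‖ ‖∇z‖`; a
second use of Poincaré controls the full norm. -/
theorem norm_le_of_inner_grad_eq {Ω : Set (Space N)} {C : ℝ} (hC : 0 ≤ C)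
    (hP : ∀ u : SobolevZero Ω, ‖u.fn‖ ≤ C * ‖u.grad‖) {z : SobolevZero Ω}
    {f : Lp ℝ 2 (volume.restrict Ω)}
    (h : ∀ u : SobolevZero Ω, inner ℝ z.grad u.grad = inner ℝ f u.fn) :
    ‖z‖ ≤ (C + 1) * C * ‖f‖ := by
  have h1 : ‖z.grad‖ ^ 2 ≤ ‖f‖ * (C * ‖z.grad‖) := by
    rw [← real_inner_self_eq_norm_sq, h z]
    exact (real_inner_le_norm _ _).trans (by gcongr; exact hP z)
  have h2 : ‖z.grad‖ ≤ C * ‖f‖ := by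
    rcases (norm_nonneg z.grad).eq_or_lt with h0 | h0
    · rw [← h0]; positivity
    · refine le_of_mul_le_mul_right ?_ h0
      calc ‖z.grad‖ * ‖z.grad‖ = ‖z.grad‖ ^ 2 := (sq _).symm
        _ ≤ _ := h1
        _ = _ := by ring
  calc ‖z‖ ≤ ‖z.fn‖ + ‖z.grad‖ := norm_le_add z
    _ ≤ C * ‖z.grad‖ + ‖z.grad‖ := by gcongr; exact hP z
    _ = (C + 1) * ‖z.grad‖ := by ring
    _ ≤ (C + 1) * (C * ‖f‖) := by gcongr
    _ = _ := by ring

/-- Stability of the Dirichlet problem: if the data converge in `L²(Ω)`, so do the solutions in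
`W^{1,2}_0(Ω)`. -/
theorem exists_tendsto_of_inner_grad_eq (hN : 1 ≤ N) {Ω : Set (Space N)}
    (hΩb : Bornology.IsBounded Ω) {W : ℕ → SobolevZero Ω}
    {f : ℕ → Lp ℝ 2 (volume.restrict Ω)} {f₀ : Lp ℝ 2 (volume.restrict Ω)}
    (h : ∀ n, ∀ u : SobolevZero Ω, inner ℝ (W n).grad u.grad = inner ℝ (f n) u.fn)
    (hf : Tendsto f atTop (𝓝 f₀)) :
    ∃ U : SobolevZero Ω, Tendsto W atTop (𝓝 U) ∧
      ∀ u : SobolevZero Ω, inner ℝ U.grad u.grad = inner ℝ f₀ u.fn := by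
  obtain ⟨C, hC, hP⟩ := exists_norm_fn_le hN hΩb
  set K := (C + 1) * C with hK
  have hK0 : 0 ≤ K := by positivity
  -- By linearity `W n - W k` solves the problem with datum `f n - f k`, so the energy estimate
  -- makes `W` Cauchy in the full Sobolev norm.
  have hd : ∀ n k, dist (W n) (W k) ≤ K * dist (f n) (f k) := by
    intro n k
    rw [dist_eq_norm, dist_eq_norm]
    refine norm_le_of_inner_grad_eq hC hP fun u => ?_
    rw [inner_sub_left, ← h n u, ← h k u, ← inner_sub_left]
    rfl
  have hcau : CauchySeq W := by
    rw [Metric.cauchySeq_iff]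
    intro ε hε
    obtain ⟨n₀, hn₀⟩ := Metric.cauchySeq_iff.1 hf.cauchySeq (ε / (K + 1)) (by positivity)
    refine ⟨n₀, fun n hn k hk => (hd n k).trans_lt ?_⟩
    have h1 := hn₀ n hn k hk
    rw [lt_div_iff₀ (by positivity)] at h1
    nlinarith [dist_nonneg (x := f n) (y := f k)]
  obtain ⟨U, hU⟩ := cauchySeq_tendsto_of_complete hcau
  refine ⟨U, hU, fun u => ?_⟩
  have l1 : Tendsto (fun n => inner ℝ (W n).grad u.grad) atTop (𝓝 (inner ℝ U.grad u.grad)) :=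
    (((gradL Ω).continuous.tendsto U).comp hU).inner tendsto_const_nhds
  have l2 : Tendsto (fun n => inner ℝ (f n) u.fn) atTop (𝓝 (inner ℝ f₀ u.fn)) :=
    hf.inner tendsto_const_nhds
  exact tendsto_nhds_unique (l1.congr fun n => h n u) l2

end SobolevZero

/-! ### Kernels in time and identification of the limit -/

/-- A smooth kernel of unit mass supported in `(0,1)`. -/
theorem exists_isTest_Ioo_integral_eq_one :
    ∃ ρ : ℝ → ℝ, IsTest (Ioo 0 1) ρ ∧ ∫ s, ρ s = 1 := by
  let φ : ContDiffBump (1 / 2 : ℝ) := ⟨1 / 8, 1 / 4, by norm_num, by norm_num⟩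
  refine ⟨φ.normed volume, ⟨φ.contDiff_normed, φ.hasCompactSupport_normed, ?_⟩, φ.integral_normed⟩
  rw [φ.tsupport_normed_eq, Real.closedBall_eq_Icc]
  change Icc (1 / 2 - 1 / 4 : ℝ) (1 / 2 + 1 / 4) ⊆ _
  exact Icc_subset_Ioo (by norm_num) (by norm_num)

theorem IsTest.comp_sub_const {ρ : ℝ → ℝ} (hρ : IsTest (Ioo 0 1) ρ) {a : ℝ} (ha : 0 ≤ a) :
    IsTest (Ioi 0) fun τ => ρ (τ - a) := by
  have hsub : tsupport (fun τ => ρ (τ - a)) ⊆ (fun τ => τ - a) ⁻¹' tsupport ρ :=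
    tsupport_comp_subset_preimage ρ (continuous_id.sub continuous_const)
  refine ⟨hρ.smooth.comp (contDiff_id.sub contDiff_const), ?_, fun τ hτ => ?_⟩
  · exact hρ.compact.comp_homeomorph (Homeomorph.subRight a)
  · have := (hρ.support_subset (hsub hτ)).1
    change 0 < τ
    linarith

theorem aestronglyMeasurable_Ioi_of_memLp_Ioc {E : Type*} [NormedAddCommGroup E] {w : ℝ → E}
    {p : ℝ≥0∞} (hw : ∀ T : ℝ, 0 < T → MemLp w p (volume.restrict (Ioc 0 T))) :
    AEStronglyMeasurable w (volume.restrict (Ioi 0)) := by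
  have hun : Ioi (0 : ℝ) = ⋃ n : ℕ, Ioc (0 : ℝ) (n + 1) := by
    ext x
    simp only [mem_Ioi, mem_iUnion, mem_Ioc]
    refine ⟨fun hx => ?_, fun ⟨n, hn⟩ => hn.1⟩
    obtain ⟨n, hn⟩ := exists_nat_ge x
    exact ⟨n, hx, by linarith⟩
  rw [hun]
  exact aestronglyMeasurable_iUnion_iff.2 fun n =>
    (hw (n + 1) (by positivity)).aestronglyMeasurable

theorem tendsto_integral_mul_Phi {X : Type*} [TopologicalSpace X] [MeasurableSpace X]
    [OpensMeasurableSpace X] {μ : Measure X} [IsFiniteMeasure μ] {ι : Type*} {l : Filter ι} {m : ℝ}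
    (hm : 1 ≤ m) {χ : X → ℝ} (hχ : Continuous χ) (hχc : HasCompactSupport χ)
    {f : ι → X → ℝ} {k : X → ℝ} (hk : MemLp k (ENNReal.ofReal (m + 1)) μ)
    (hf : ∀ᶠ i in l, MemLp (f i) (ENNReal.ofReal (m + 1)) μ)
    (h : Tendsto (fun i => eLpNorm (f i - k) (ENNReal.ofReal (m + 1)) μ) l (𝓝 0)) :
    Tendsto (fun i => ∫ x, χ x * Phi m (f i x) ∂μ) l (𝓝 (∫ x, χ x * Phi m (k x) ∂μ)) := by
  obtain ⟨B, hB⟩ := hχc.exists_bound_of_continuous hχ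
  have hχi : ∀ {z : X → ℝ}, Integrable z μ → Integrable (fun x => χ x * z x) μ :=
    fun hz => hz.bdd_mul hχ.aestronglyMeasurable (Eventually.of_forall hB)
  refine tendsto_integral_of_L1' _ (hχi (integrable_Phi hm hk)).aestronglyMeasurable
    (hf.mono fun i hi => hχi (integrable_Phi hm hi)) ?_
  have hlim := ENNReal.Tendsto.const_mul (a := ENNReal.ofReal B) (tendsto_eLpNorm_Phi_sub hm hk
    (hf.mono fun i hi => hi.aestronglyMeasurable) h) (Or.inr ENNReal.ofReal_ne_top)
  rw [mul_zero] at hlim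
  refine tendsto_of_tendsto_of_tendsto_of_le_of_le tendsto_const_nhds hlim
    (fun _ => zero_le) fun i => ?_
  refine eLpNorm_le_mul_eLpNorm_of_ae_le_mul (Eventually.of_forall fun x => ?_) 1
  rw [Pi.sub_apply, ← mul_sub, norm_mul]
  exact mul_le_mul_of_nonneg_right (hB x) (norm_nonneg _)

/-- If time averages of `Φ(v)` converge in `W^{1,2}_0(Ω)` and `v` converges to `ψ` uniformly on the
averaging windows, then the limit is `Φ(ψ)`. -/
theorem ae_eq_Phi_of_tendsto_average {m : ℝ} (hm : 1 ≤ m) {Ω : Set (Space N)} (hΩ : IsOpen Ω)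
    [IsFiniteMeasure (volume.restrict Ω)] {v : ℝ → Space N → ℝ}
    (hv : ∀ t, 0 ≤ t → MemLp (v t) (ENNReal.ofReal (m + 1)) (volume.restrict Ω))
    {w : ℝ → SobolevZero Ω} (hwΦ : ∀ᵐ t ∂volume.restrict (Ioi (0 : ℝ)),
      (w t).fn =ᵐ[volume.restrict Ω] fun x => Phi m (v t x))
    (hw : ∀ T : ℝ, 0 < T → MemLp w 2 (volume.restrict (Ioc 0 T))) {ψ : Space N → ℝ}
    (hψm : MemLp ψ (ENNReal.ofReal (m + 1)) (volume.restrict Ω)) {t : ℕ → ℝ} (ht0 : ∀ n, 0 ≤ t n)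
    (hunif : Tendsto (fun p : ℕ × ℝ => eLpNorm (v (t p.1 + p.2) - ψ) (ENNReal.ofReal (m + 1))
      (volume.restrict Ω)) (atTop ×ˢ 𝓟 (Icc 0 1)) (𝓝 0))
    {ρ : ℝ → ℝ} (hρ : IsTest (Ioo 0 1) ρ) (hρ1 : ∫ s, ρ s = 1) {U : SobolevZero Ω}
    (hU : Tendsto (fun n => ∫ τ in Ioi (0 : ℝ), ρ (τ - t n) • w τ) atTop (𝓝 U)) :
    U.fn =ᵐ[volume.restrict Ω] fun x => Phi m (ψ x) := by
  have hnonneg : ∀ᶠ p : ℕ × ℝ in atTop ×ˢ 𝓟 (Icc 0 1), 0 ≤ t p.1 + p.2 := by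
    rw [eventually_prod_principal_iff]
    exact Eventually.of_forall fun n s hs => add_nonneg (ht0 n) hs.1
  have hρ0 : ∀ s, s ∉ Ioo (0 : ℝ) 1 → ρ s = 0 := fun s hs =>
    image_eq_zero_of_notMem_tsupport fun h => hs (hρ.support_subset h)
  refine ae_eq_of_integral_mul_isTest hΩ ((Lp.memLp U.fn).integrable (by norm_num))
    (integrable_Phi hm hψm) fun χ hχ => ?_
  obtain ⟨u, hu, -⟩ := SobolevZero.exists_of_isTest hχ
  have hpair : ∀ z : Lp ℝ 2 (volume.restrict Ω), inner ℝ u.fn z = ∫ x in Ω, χ x * z x := by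
    intro z
    rw [L2.inner_def]
    refine integral_congr_ae ?_
    filter_upwards [hu] with x hx
    rw [hx]; simp [mul_comm]
  -- `Φ(v)` is controlled here only in `L¹`, so the comparison is made after pairing with a test
  -- function. `J` is built from `v`, which converges at every time of the window, whereas `w`
  -- represents `Φ(v)` only at almost every time.
  let J : ℝ → ℝ := fun τ => ∫ x in Ω, χ x * Phi m (v τ x)
  have hJw : ∀ᵐ τ ∂volume.restrict (Ioi (0 : ℝ)), inner ℝ u.fn (w τ).fn = J τ := by
    filter_upwards [hwΦ] with τ hτ
    rw [hpair]
    refine integral_congr_ae ?_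
    filter_upwards [hτ] with x hx
    rw [hx]
  have hJmeas : AEStronglyMeasurable J (volume.restrict (Ioi 0)) :=
    ((((innerSL ℝ u.fn).comp (SobolevZero.fnL Ω)).continuous.comp_aestronglyMeasurable
      (aestronglyMeasurable_Ioi_of_memLp_Ioc hw)).congr hJw)
  have hJlim : Tendsto (fun p : ℕ × ℝ => J (t p.1 + p.2)) (atTop ×ˢ 𝓟 (Icc 0 1))
      (𝓝 (∫ x in Ω, χ x * Phi m (ψ x))) := by
    exact tendsto_integral_mul_Phi hm hχ.smooth.continuous hχ.compact hψm
      (hnonneg.mono fun p hp => hv _ hp) hunif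
  have hWJ : ∀ n, inner ℝ u.fn (SobolevZero.fn (∫ τ in Ioi (0 : ℝ), ρ (τ - t n) • w τ)) = ∫ τ in Ioi (0 : ℝ), ρ (τ - t n) • J τ := by
    intro n
    have hσ := hρ.comp_sub_const (ht0 n)
    have hi : IntegrableOn (fun τ => ρ (τ - t n) • w τ) (Ioi 0) :=
      integrableOn_Ioi_smul hσ.smooth.continuous hσ.compact
        fun T hT => (hw T hT).integrable (by norm_num)
    refine (ContinuousLinearMap.integral_comp_comm
      ((innerSL ℝ u.fn).comp (SobolevZero.fnL Ω)) hi).symm.trans (integral_congr_ae ?_)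
    filter_upwards [hJw] with τ hτ
    change inner ℝ u.fn (SobolevZero.fnL Ω (ρ (τ - t n) • w τ)) = _
    rw [map_smul, inner_smul_right, ← hτ]
    rfl
  have l1 : Tendsto (fun n => inner ℝ u.fn (SobolevZero.fn (∫ τ in Ioi (0 : ℝ), ρ (τ - t n) • w τ))) atTop (𝓝 (inner ℝ u.fn U.fn)) :=
    tendsto_const_nhds.inner (((SobolevZero.fnL Ω).continuous.tendsto U).comp hU)
  have l2 := tendsto_integral_translate_smul hρ.smooth.continuous hρ0 hJmeas ht0 hJlim
  rw [hρ1, one_smul] at l2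
  rw [← hpair]
  exact tendsto_nhds_unique (l1.congr hWJ) l2

/-! ### Passage to the limit in the averaged equation -/

/-- The `ω`-limit points of `v` solve the Lane–Emden equation. The proof passes to the limit in time
averages of the equation, in which the gradients converge strongly. -/
theorem IsWeakSolution.exists_isLaneEmdenSolution (hN : 1 ≤ N) {m : ℝ} (hm : 1 < m)
    {Ω : Set (Space N)} (hΩ : IsOpen Ω) (hΩb : Bornology.IsBounded Ω)
    {u₀ : Space N → ℝ} {v : ℝ → Space N → ℝ} (hv : IsWeakSolution Ω m u₀ v) {T₀ : ℝ} (hT₀ : 0 < T₀)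
    (hg : TimeDerivMemL2L2 Ω T₀ (fun t x => g m (v t x)))
    {ψ : Space N → ℝ} (hψ : ψ ∈ omegaLimitSet Ω m v) :
    ∃ U : SobolevZero Ω, U.fn =ᵐ[volume.restrict Ω] (fun x => Phi m (ψ x)) ∧
      IsLaneEmdenSolution Ω ((m + 1) / m) (1 / (m - 1)) U := by
  obtain ⟨hψm, t, ht0, -, ht, htψ⟩ := hψ
  obtain ⟨w, hwΦ, hw, heq⟩ := hv.equation
  set α := 1 / (m - 1) with hα
  have hm0 : 0 < m := by linarith
  have : IsFiniteMeasure (volume.restrict Ω : Measure (Space N)) :=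
    isFiniteMeasure_restrict.2 hΩb.measure_lt_top.ne
  have h2p : 2 ≤ ENNReal.ofReal (m + 1) := by
    rw [show (2 : ℝ≥0∞) = ENNReal.ofReal 2 by simp]
    exact ENNReal.ofReal_le_ofReal (by linarith)
  have hunif := hv.tendsto_eLpNorm_sub_of_omegaLimit hm.le hT₀ hg hψm ht0 ht htψ
  have hnonneg : ∀ᶠ p : ℕ × ℝ in atTop ×ˢ 𝓟 (Icc 0 1), 0 ≤ t p.1 + p.2 := by
    rw [eventually_prod_principal_iff]
    exact Eventually.of_forall fun n s hs => add_nonneg (ht0 n) hs.1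
  -- the curve `v` in `L²(Ω)`
  obtain ⟨V, hV⟩ : ∃ V : ℝ → Lp ℝ 2 (volume.restrict Ω),
      ∀ t, 0 ≤ t → V t =ᵐ[volume.restrict Ω] v t := by
    have : ∀ t, ∃ Vt : Lp ℝ 2 (volume.restrict Ω), 0 ≤ t → Vt =ᵐ[volume.restrict Ω] v t := by
      intro t
      by_cases h : 0 ≤ t
      · exact ⟨((hv.memLp t h).mono_exponent h2p).toLp _, fun _ => MemLp.coeFn_toLp _⟩
      · exact ⟨0, fun h' => absurd h' h⟩
    exact Classical.axiomOfChoice this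
  have hVc : ContinuousOn V (Ici 0) := fun s hs =>
    tendsto_Lp_two_of_tendsto_eLpNorm h2p
      (eventually_nhdsWithin_of_forall fun t ht => hV t ht) (hV s hs) (hv.continuous s hs)
  let Ψ : Lp ℝ 2 (volume.restrict Ω) := (hψm.mono_exponent h2p).toLp ψ
  have hΨψ : Ψ =ᵐ[volume.restrict Ω] ψ := MemLp.coeFn_toLp _
  have hVΨ : Tendsto (fun p : ℕ × ℝ => V (t p.1 + p.2)) (atTop ×ˢ 𝓟 (Icc 0 1)) (𝓝 Ψ) :=
    tendsto_Lp_two_of_tendsto_eLpNorm h2p (hnonneg.mono fun p hp => hV _ hp) hΨψ hunif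
  have hVmeas : AEStronglyMeasurable V (volume.restrict (Ioi 0)) :=
    (hVc.mono Ioi_subset_Ici_self).aestronglyMeasurable measurableSet_Ioi
  -- averages in time
  obtain ⟨ρ, hρ, hρ1⟩ := exists_isTest_Ioo_integral_eq_one
  have hρ0 : ∀ s, s ∉ Ioo (0 : ℝ) 1 → ρ s = 0 := fun s hs =>
    image_eq_zero_of_notMem_tsupport fun h => hs (hρ.support_subset h)
  have hρd0 : ∀ s, s ∉ Ioo (0 : ℝ) 1 → deriv ρ s = 0 := fun s hs =>
    image_eq_zero_of_notMem_tsupport fun h => hs (hρ.support_subset (tsupport_deriv_subset h))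
  have hρi : Integrable ρ := hρ.smooth.continuous.integrable_of_hasCompactSupport hρ.compact
  have hρdi : Integrable (deriv ρ) :=
    hρ.deriv_continuous.integrable_of_hasCompactSupport hρ.compact.deriv
  have hρd1 : ∫ s, deriv ρ s = 0 :=
    integral_eq_zero_of_hasDerivAt_of_integrable
      (fun s => (hρ.smooth.differentiable (by simp) s).hasDerivAt) hρdi hρi
  -- The time derivative disappears in the limit because `ρ'` has zero mean; only `α` survives.
  have hκ1 : ∫ s, (deriv ρ s + α * ρ s) = α := by
    rw [integral_add hρdi (hρi.const_mul α), integral_const_mul, hρd1, hρ1, zero_add, mul_one]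
  let W : ℕ → SobolevZero Ω := fun n => ∫ τ in Ioi (0 : ℝ), ρ (τ - t n) • w τ
  let f : ℕ → Lp ℝ 2 (volume.restrict Ω) := fun n =>
    ∫ τ in Ioi (0 : ℝ), (deriv ρ (τ - t n) + α * ρ (τ - t n)) • V τ
  have hWf : ∀ n, ∀ u : SobolevZero Ω, inner ℝ (W n).grad u.grad = inner ℝ (f n) u.fn := by
    intro n u
    have := inner_grad_integral_eq hw heq hVc hV (hρ.comp_sub_const (ht0 n)) u
    simpa only [deriv_comp_sub_const] using this
  have hflim : Tendsto f atTop (𝓝 (α • Ψ)) := by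
    have := tendsto_integral_translate_smul (κ := fun s => deriv ρ s + α * ρ s)
      (hρ.deriv_continuous.add (continuous_const.mul hρ.smooth.continuous))
      (fun s hs => by rw [hρ0 s hs, hρd0 s hs]; simp) hVmeas ht0 hVΨ
    rwa [hκ1] at this
  obtain ⟨U, hU, hUeq⟩ := SobolevZero.exists_tendsto_of_inner_grad_eq hN hΩb hWf hflim
  have hUψ : U.fn =ᵐ[volume.restrict Ω] fun x => Phi m (ψ x) :=
    ae_eq_Phi_of_tendsto_average hm.le hΩ hv.memLp hwΦ hw hψm ht0 hunif hρ hρ1 hU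
  refine ⟨U, hUψ, fun φ => ?_⟩
  have h1 := hUeq φ
  rw [inner_smul_left, L2.inner_def, L2.inner_def] at h1
  refine h1.trans ?_
  simp only [conj_trivial]
  congr 1
  refine integral_congr_ae ?_
  filter_upwards [hUψ, hΨψ] with x hx hx'
  -- With `U = Φ(ψ)` and `q = (m + 1) / m`, the power `|U|^(q-2) U` is `ψ` itself.
  rw [hx, hx', abs_Phi_rpow_mul_Phi hm0]
  simp [mul_comm]

end PorousMedium

theorem theorem5p2 {N : ℕ} (hN : 1 ≤ N) {m : ℝ} (hm : 1 < m)
    {Ω : Set (PorousMedium.Space N)} (hΩ : IsOpen Ω) (hΩb : Bornology.IsBounded Ω)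
    {u₀ : PorousMedium.Space N → ℝ}
    (hu₀ : MemLp u₀ (ENNReal.ofReal (m + 1)) (volume.restrict Ω))
    (hΦu₀ : PorousMedium.MemSobolevZero Ω (fun x => PorousMedium.Phi m (u₀ x)))
    {v : ℝ → PorousMedium.Space N → ℝ} (hv : PorousMedium.IsWeakSolution Ω m u₀ v)
    {T₀ : ℝ} (hT₀ : 0 < T₀)
    (hg : PorousMedium.TimeDerivMemL2L2 Ω T₀ (fun t x => PorousMedium.g m (v t x)))
    (hΦ : PorousMedium.GradMemLinftyL2 Ω T₀ (fun t x => PorousMedium.Phi m (v t x)))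
    {ψ : PorousMedium.Space N → ℝ} (hψ : ψ ∈ PorousMedium.omegaLimitSet Ω m v) :
    ∃ U : PorousMedium.SobolevZero Ω,
      U.fn =ᵐ[volume.restrict Ω] (fun x => PorousMedium.Phi m (ψ x)) ∧
      PorousMedium.IsLaneEmdenSolution Ω ((m + 1) / m) (1 / (m - 1)) U := by
  exact hv.exists_isLaneEmdenSolution hN hm hΩ hΩb hT₀ hg hψ
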